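/- For integers $\lambda\ge 0$, let $\mathbf D^{\lambda}$ be the $(2\lambda+1)\times(2\lambda+1)$ Wigner matrices with respect to the real spherical harmonics, with rows and columns indexed by $\mu=-\lambda,\dots,\lambda$. For tensors $\mathbf A\in\mathbb C^{2l_1+1}$, $\mathbf B\in\mathbb C^{2l_2+1}$ let $(\mathbf A\,\widetilde\otimes\,\mathbf B)_{L}\in\mathbb C^{2L+1}$ be their Clebsch--Gordan contraction, $(\mathbf A\,\widetilde\otimes\,\mathbf B)_{L\mu}=\sum_{\mu_1,\mu_2}C^{L\mu}_{l_1\mu_1l_2\mu_2}A_{\mu_1}B_{\mu_2}$, with the Clebsch--Gordan coefficients for real spherical harmonics. A vector $\mathbf a\in\mathbb R^3$ is identified with its harmonic components of degree one, $a_{-1}=a_x$, $a_0=a_z$, $a_1=a_y$ (the real harmonics of degree one and orders $-1,0,1$ being proportional to $x,z,y$). Let $n,\lambda\ge 0$, and let $\mathbf\Theta_\lambda:(\mathbb R^3)^n\to\mathbb R^{2\lambda+1}$ be a harmonic pseudotensor that depends $O(3)$-equivariantly on the input vectors: for every $Q\in O(3)$ and all $\mathbf r_1,\dots,\mathbf r_n\in\mathbb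 R^3$, $$\mathbf\Theta_\lambda(Q\mathbf r_1,\dots,Q\mathbf r_n)=\mathbf Q^{(\lambda)}\,\mathbf\Theta_\lambda(\mathbf r_1,\dots,\mathbf r_n),$$ where $\mathbf Q^{(\lambda)}=\mathbf D^\lambda(Q)$ if $Q$ is a rotation, and $\mathbf Q^{(\lambda)}=-(-1)^\lambda\mathbf D^\lambda(R)$ if $Q=-R$ with $R$ a rotation. Then: 1. If $\lambda\ge 1$, then for all $\mathbf r_1,\dots,\mathbf r_n\in\mathbb R^3$ the tensor $\mathbf\Theta_\lambda(\mathbf r_1,\dots,\mathbf r_n)$ lies in the complex linear span of the pseudo-maximal couplings $$\Big(\cdots\big(\big((\mathbf r_{i_0}\,\widetilde\otimes\,\mathbf r_{i_1})_1\,\widetilde\otimes\,\mathbf r_{i_2}\big)_2\,\widetilde\otimes\,\mathbf r_{i_3}\big)_3\cdots\,\widetilde\otimes\,\mathbf r_{i_\lambda}\Big)_\lambda,\qquad i_0,\dots,i_\lambda\in\{1,\dots,n\};$$ moreover, it is $\mathrm i$ times a linear combination of them with real coefficients. 2. Each of these couplings contains exactly one cross product, namely its innermost contraction: $(\mathbf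 a\,\widetilde\otimes\,\mathbf b)_1=-\tfrac{\mathrm i}{\sqrt2}\,\mathbf a\times\mathbf b$ for all $\mathbf a,\mathbf b\in\mathbb R^3$. 3. If $\mathbf r_1,\dots,\mathbf r_n$ are collinear, that is, all are multiples of a single vector, then $\mathbf\Theta_\lambda(\mathbf r_1,\dots,\mathbf r_n)=0$ (for every $\lambda\ge0$). -/

import Mathlib

open scoped Nat Matrix

namespace Harmonic

noncomputable section

/-- The orders `m = -l, …, l` of angular momentum `l`. -/
abbrev Order (l : ℕ) : Type := ↥(Finset.Icc (-(l : ℤ)) (l : ℤ))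

/-- Factorial of an integer that is known to be nonnegative. -/
def fac (k : ℤ) : ℝ := (k.toNat ! : ℝ)

/-- Reciprocal factorial `1 / k!` of an integer, with the usual value `0` for `k < 0`; it
restricts the sums below to the terms all of whose factorials make sense. -/
def invFac (k : ℤ) : ℝ := if 0 ≤ k then ((k.toNat ! : ℝ))⁻¹ else 0

/-- The Clebsch–Gordan coefficient `⟨l₁ m₁ l₂ m₂ | L M⟩` for the complex spherical harmonics
(Condon–Shortley phases), by Racah's formula. -/
def clebschGordan (l₁ l₂ L : ℕ) (m₁ m₂ M : ℤ) : ℝ :=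
  if m₁ + m₂ = M ∧ |(l₁ : ℤ) - l₂| ≤ L ∧ L ≤ l₁ + l₂ then
    Real.sqrt ((2 * L + 1) * fac ((L : ℤ) + l₁ - l₂) * fac ((L : ℤ) - l₁ + l₂)
        * fac ((l₁ : ℤ) + l₂ - L) * invFac ((l₁ : ℤ) + l₂ + L + 1))
      * Real.sqrt (fac (L + M) * fac (L - M) * fac (l₁ - m₁) * fac (l₁ + m₁)
        * fac (l₂ - m₂) * fac (l₂ + m₂))
      * ∑ k ∈ Finset.range (l₁ + l₂ + 1), (-1 : ℝ) ^ k * invFac k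
          * invFac ((l₁ : ℤ) + l₂ - L - k) * invFac (l₁ - m₁ - k) * invFac (l₂ + m₂ - k)
          * invFac ((L : ℤ) - l₂ + m₁ + k) * invFac ((L : ℤ) - l₁ - m₂ + k)
  else 0

/-- The unitary change of basis `Y^real_μ = ∑ₘ U_{μ m} Y_m` from complex to real spherical
harmonics: `Y^real_0 = Y_0`, and up to the factor `(-1)^μ √2` the real harmonic of order `μ` is
`Re Y_{|μ|}` for `μ < 0` and `Im Y_{|μ|}` for `μ > 0`. In degree one the real harmonics of orders
`-1, 0, 1` are proportional to `x, z, y`. -/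
def realU (μ m : ℤ) : ℂ :=
  if μ = 0 then (if m = 0 then 1 else 0)
  else if μ < 0 then
    (if m = μ then 1 / (Real.sqrt 2 : ℂ)
      else if m = -μ then (-1) ^ μ.natAbs / (Real.sqrt 2 : ℂ) else 0)
  else
    (if m = -μ then Complex.I / (Real.sqrt 2 : ℂ)
      else if m = μ then -Complex.I * (-1) ^ μ.natAbs / (Real.sqrt 2 : ℂ) else 0)

/-- The Clebsch–Gordan coefficient for components with respect to the real spherical harmonics.
(Components transform with the complex conjugate of `realU`.) -/
def realCG (l₁ l₂ L : ℕ) (μ₁ : Order l₁) (μ₂ : Order l₂) (μ : Order L) : ℂ :=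
  ∑ m : Order L, ∑ m₁ : Order l₁, ∑ m₂ : Order l₂,
    star (realU μ m) * (clebschGordan l₁ l₂ L m₁ m₂ m : ℂ) * realU μ₁ m₁ * realU μ₂ m₂

/-- The Clebsch–Gordan contraction `(A ⊗̃ B)_L` of two harmonic tensors of degrees `l₁`, `l₂`. -/
def contract {l₁ l₂ : ℕ} (L : ℕ) (A : Order l₁ → ℂ) (B : Order l₂ → ℂ) : Order L → ℂ :=
  fun μ => ∑ μ₁ : Order l₁, ∑ μ₂ : Order l₂, realCG l₁ l₂ L μ₁ μ₂ μ * (A μ₁ * B μ₂)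

/-- The harmonic components `a_{-1} = a_x`, `a_0 = a_z`, `a_1 = a_y` of a vector. -/
def ofVec (a : Fin 3 → ℝ) : Order 1 → ℂ :=
  fun μ => if (μ : ℤ) = -1 then (a 0 : ℂ) else if (μ : ℤ) = 0 then (a 2 : ℂ) else (a 1 : ℂ)

/-- The pseudo-maximal coupling `((⋯((a₀ ⊗̃ a₁)₁ ⊗̃ a₂)₂ ⊗̃ ⋯) ⊗̃ a_l)_l` of `l + 1` vectors,
meaningful for `l ≥ 1`: the first two vectors are contracted to degree one, and the others are then
contracted one by one to the maximal degree. -/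
def pseudoMaximal : (l : ℕ) → (Fin (l + 1) → Fin 3 → ℝ) → Order l → ℂ
  | 0, _ => 0
  | 1, a => contract 1 (ofVec (a 0)) (ofVec (a 1))
  | l + 2, a =>
      contract (l + 2) (pseudoMaximal (l + 1) fun j => a j.castSucc)
        (ofVec (a (Fin.last (l + 2))))

/-- Rotation by the angle `t` about the `z` axis. -/
def rotZ (t : ℝ) : Matrix (Fin 3) (Fin 3) ℝ :=
  !![Real.cos t, -Real.sin t, 0; Real.sin t, Real.cos t, 0; 0, 0, 1]

/-- Rotation by the angle `t` about the `y` axis. -/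
def rotY (t : ℝ) : Matrix (Fin 3) (Fin 3) ℝ :=
  !![Real.cos t, 0, Real.sin t; 0, 1, 0; -Real.sin t, 0, Real.cos t]

/-- The rotation with Euler angles `α, β, γ` (`z`-`y`-`z` convention, active). -/
def rotation (α β γ : ℝ) : Matrix (Fin 3) (Fin 3) ℝ := rotZ α * rotY β * rotZ γ

/-- The small Wigner matrix `d^l_{m' m}(β)`, by Wigner's formula. -/
def smallD (l : ℕ) (m' m : ℤ) (β : ℝ) : ℝ :=
  Real.sqrt (fac (l + m') * fac (l - m') * fac (l + m) * fac (l - m))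
    * ∑ s ∈ Finset.range (2 * l + 1), (-1 : ℝ) ^ (m' - m + s)
        * invFac (l + m - s) * invFac s * invFac (m' - m + s) * invFac (l - m' - s)
        * Real.cos (β / 2) ^ (2 * l + m - m' - 2 * s).toNat
        * Real.sin (β / 2) ^ (m' - m + 2 * s).toNat

/-- The Wigner matrix `D^l_{m' m}(α, β, γ) = e^{-i m' α} d^l_{m' m}(β) e^{-i m γ}` for the complex
spherical harmonics. -/
def wignerD (l : ℕ) (α β γ : ℝ) (m' m : ℤ) : ℂ :=
  Complex.exp (-Complex.I * m' * α) * (smallD l m' m β : ℂ) * Complex.exp (-Complex.I * m * γ)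

/-- The Wigner matrix for the real spherical harmonics. Its entries are real numbers; they are
regarded as complex numbers here. -/
def realWignerD (l : ℕ) (α β γ : ℝ) : Matrix (Order l) (Order l) ℂ :=
  Matrix.of fun μ μ' => ∑ m : Order l, ∑ m' : Order l,
    star (realU μ m) * wignerD l α β γ m m' * realU μ' m'

/-- `A` is the matrix by which the orthogonal transformation `Q` acts on pseudotensors of degree `l`:
a rotation acts by the real Wigner matrix of its Euler angles, and the inversion acts by the
sign `-(-1)^l`. -/
def IsPseudoRep (l : ℕ) (Q : Matrix (Fin 3) (Fin 3) ℝ) (A : Matrix (Order l) (Order l) ℂ) : Prop :=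
  ∃ α β γ : ℝ, (Q = rotation α β γ ∧ A = realWignerD l α β γ) ∨
    (Q = -rotation α β γ ∧ A = (-(-1 : ℂ) ^ l) • realWignerD l α β γ)

/-- A real harmonic tensor, regarded as having complex components. -/
def toComplex {l : ℕ} (T : Order l → ℝ) : Order l → ℂ := fun μ => (T μ : ℂ)

/-- `Θ` is a harmonic pseudotensor of degree `l` that depends `O(3)`-equivariantly on `n` vectors. -/
def IsPseudotensor {n l : ℕ} (Θ : (Fin n → Fin 3 → ℝ) → Order l → ℝ) : Prop :=
  ∀ Q ∈ Matrix.orthogonalGroup (Fin 3) ℝ, ∀ A : Matrix (Order l) (Order l) ℂ, IsPseudoRep l Q A →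
    ∀ r : Fin n → Fin 3 → ℝ, toComplex (Θ fun i => Q *ᵥ r i) = A *ᵥ toComplex (Θ r)

end

end Harmonic

namespace Harmonic

noncomputable section

/-! A tensor of degree `l` is encoded, through its components in the complex harmonics, as a binary
form of degree `2l` in `u, v`; order `m` belongs to `u^(l+m) v^(l-m)`. In this picture contraction
to maximal degree is multiplication of forms (`binaryForm_contract_add`), Wigner matrices act by
SU(2) substitutions in `(u, v)` (`binaryForm_realWignerD`), and vectors are quadratic forms. Since
the innermost contraction is a cross product up to a scalar (`contract_one_ofVec`), a pseudo-maximal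
coupling is, up to that scalar, the form of one cross product times the forms of the other inputs.

Membership in the span depends on the dimension of the space spanned by the inputs. If it is three,
the cross products and the inputs each give all of `u^2, uv, v^2`, so the couplings span every form
of degree `2l`. If it is two, equivariance moves the inputs to the horizontal plane. Reflection in
that plane fixes them and kills the components with `l + m` even. The surviving monomials have odd
exponents, hence are `uv`, the form of the vertical cross product, times products of `u^2` and
`v^2`, which come from horizontal vectors. If it is at most one, the inputs may be put on the third
axis: rotations about it leave only order `0`, and a reflection fixing the axis reverses the sign of
that component, so the tensor vanishes.

For real coefficients, `i` times a coupling is a real tensor, because the maximal Clebsch–Gordan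
coefficients are real in the real basis; the real parts of complex coefficients then suffice. -/

theorem fac_pos (k : ℤ) : 0 < fac k := by unfold fac; positivity

theorem fac_natCast (k : ℕ) : fac k = k ! := by simp [fac]

theorem invFac_natCast (k : ℕ) : invFac k = (k ! : ℝ)⁻¹ := by simp [invFac]

theorem invFac_of_neg {k : ℤ} (hk : k < 0) : invFac k = 0 := by simp [invFac, hk]

theorem invFac_of_nonneg {k : ℤ} (hk : 0 ≤ k) : invFac k = (fac k)⁻¹ := by simp [invFac, fac, hk]

theorem Order.le {l : ℕ} (m : Order l) : (m : ℤ) ≤ l := (Finset.mem_Icc.1 m.2).2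

theorem Order.neg_le {l : ℕ} (m : Order l) : -(l : ℤ) ≤ m := (Finset.mem_Icc.1 m.2).1

theorem sum_order {M : Type*} [AddCommMonoid M] (l : ℕ) (f : ℤ → M) :
    ∑ m : Order l, f m = ∑ m ∈ Finset.Icc (-(l : ℤ)) l, f m :=
  Finset.sum_coe_sort (Finset.Icc (-(l : ℤ)) l) f

/-! ### Change of basis between real and complex harmonics. -/

/-- The diagonal coefficient `U_{μ μ}` (with `1` at `μ = 0`). -/
def diagU (μ : ℤ) : ℂ :=
  if μ = 0 then 1 else if μ < 0 then 1 / (Real.sqrt 2 : ℂ)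
    else -Complex.I * (-1) ^ μ.natAbs / (Real.sqrt 2 : ℂ)

/-- The antidiagonal coefficient `U_{μ, -μ}` (with `0` at `μ = 0`). -/
def antiU (μ : ℤ) : ℂ :=
  if μ = 0 then 0 else if μ < 0 then (-1) ^ μ.natAbs / (Real.sqrt 2 : ℂ)
    else Complex.I / (Real.sqrt 2 : ℂ)

theorem realU_eq (μ m : ℤ) :
    realU μ m = (if m = μ then diagU μ else 0) + (if m = -μ then antiU μ else 0) := by
  unfold realU diagU antiU
  rcases lt_trichotomy μ 0 with h | h | h
  · have h1 : μ ≠ 0 := by omega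
    have h2 : μ ≠ -μ := by omega
    by_cases h3 : m = μ
    · subst h3; simp [h, h1, h2]
    · simp [h, h1, h3]
  · subst h; simp
  · have h1 : μ ≠ 0 := by omega
    have h0 : ¬ μ < 0 := by omega
    have h2 : -μ ≠ μ := by omega
    by_cases h3 : m = -μ
    · subst h3; simp [h0, h1, h2]
    · simp [h0, h1, h3]

theorem ofReal_sqrt_two_sq : (Real.sqrt 2 : ℂ) ^ 2 = 2 := by
  rw [← Complex.ofReal_pow, Real.sq_sqrt (by norm_num)]; norm_num

theorem ofReal_sqrt_two_ne : (Real.sqrt 2 : ℂ) ≠ 0 := by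
  intro h; have := ofReal_sqrt_two_sq; rw [h] at this; norm_num at this

theorem star_diagU_mul_add (μ : ℤ) :
    star (diagU μ) * diagU μ + star (antiU μ) * antiU μ = 1 := by
  have h2 := ofReal_sqrt_two_sq
  have h0 := ofReal_sqrt_two_ne
  have hs : ((-1 : ℂ) ^ μ.natAbs) ^ 2 = 1 := by rw [← pow_mul, mul_comm, pow_mul]; simp
  unfold diagU antiU
  rcases lt_trichotomy μ 0 with h | h | h
  · have h1 : μ ≠ 0 := by omega
    simp only [h, h1, if_true, if_false, Complex.star_def, map_div₀, map_one, map_pow, map_neg,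
      Complex.conj_ofReal]
    field_simp
    rw [h2, hs]; norm_num
  · subst h; simp
  · have h1 : μ ≠ 0 := by omega
    have h1' : ¬ μ < 0 := by omega
    simp only [h1', h1, if_false, Complex.star_def, map_div₀, map_one, map_pow, map_neg,
      Complex.conj_ofReal, map_mul, Complex.conj_I]
    field_simp
    rw [h2]; linear_combination (-1-((-1 : ℂ) ^ μ.natAbs) ^ 2) * Complex.I_sq + hs

theorem star_diagU_mul_antiU (μ : ℤ) :
    star (diagU μ) * antiU (-μ) + star (antiU μ) * diagU (-μ) = 0 := by
  have hs : ((-1 : ℂ) ^ μ.natAbs) ^ 2 = 1 := by rw [← pow_mul, mul_comm, pow_mul]; simp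
  have h0 := ofReal_sqrt_two_ne
  unfold diagU antiU
  rcases lt_trichotomy μ 0 with h | h | h
  · have h1 : μ ≠ 0 := by omega
    have h1' : ¬ -μ < 0 := by omega
    have h1'' : -μ ≠ 0 := by omega
    simp only [h, h1, h1', h1'', if_true, if_false, Complex.star_def, map_div₀, map_one, map_pow,
      map_neg, Complex.conj_ofReal, Int.natAbs_neg]
    field_simp
    linear_combination (-Complex.I) * hs
  · subst h; simp
  · have h1 : μ ≠ 0 := by omega
    have h1' : ¬ μ < 0 := by omega
    have h1'' : -μ ≠ 0 := by omega
    have h1''' : -μ < 0 := by omega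
    simp only [h1, h1', h1'', h1''', if_true, if_false, Complex.star_def, map_div₀, map_one,
      map_pow, map_neg, Complex.conj_ofReal, Int.natAbs_neg, map_mul, Complex.conj_I]
    field_simp
    linear_combination Complex.I * hs

/-- The matrix of the change of basis between complex and real spherical harmonics. -/
def realUMatrix (l : ℕ) : Matrix (Order l) (Order l) ℂ := Matrix.of fun μ m => realU μ m

/-- Row `μ` is supported on the columns `μ` and `-μ`, so two rows interact only when their orders
agree up to sign. Order `0` is separate because there the two columns coincide. -/
theorem realUMatrix_mul_conjTranspose (l : ℕ) : realUMatrix l * (realUMatrix l)ᴴ = 1 := by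
  ext μ μ'
  rw [Matrix.mul_apply]
  simp only [realUMatrix, Matrix.of_apply, Matrix.conjTranspose_apply]
  rw [sum_order l fun m => realU μ m * star (realU μ' m)]
  have hμ := Finset.mem_Icc.1 μ.2
  have hn : -(μ' : ℤ) ∈ Finset.Icc (-(l : ℤ)) l := by
    have := Finset.mem_Icc.1 μ'.2; rw [Finset.mem_Icc]; omega
  have hn' : -(μ : ℤ) ∈ Finset.Icc (-(l : ℤ)) l := by
    rw [Finset.mem_Icc]; omega
  simp only [realU_eq μ, add_mul, Finset.sum_add_distrib, ite_mul, zero_mul, Finset.sum_ite_eq',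
    μ.2, hn', if_true]
  rw [realU_eq, realU_eq, Matrix.one_apply]
  by_cases h : μ = μ'
  · subst h
    have h1 := star_diagU_mul_add μ
    have h2 := star_diagU_mul_antiU μ
    by_cases h0 : (μ : ℤ) = 0
    · simp [h0, diagU, antiU]
    · have : (μ : ℤ) ≠ -μ := by omega
      have h' : -(μ : ℤ) ≠ μ := by omega
      simp only [this, h', if_true, if_false, add_zero, zero_add]
      linear_combination h1
  · have hne : (μ : ℤ) ≠ μ' := fun e => h (Subtype.ext e)
    have hne' : -(μ : ℤ) ≠ -μ' := by omega
    by_cases h3 : (μ : ℤ) = -μ'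
    · have h4 : -(μ : ℤ) = μ' := by omega
      have h2 := star_diagU_mul_antiU μ'
      rw [h3] at hne
      have hne2 : (μ' : ℤ) ≠ -μ' := hne.symm
      simp only [h, hne, hne2, h3, neg_neg, if_true, if_false, add_zero, zero_add]
      linear_combination h2
    · have h4 : -(μ : ℤ) ≠ μ' := by omega
      simp [h, hne, h3, h4]

theorem conjTranspose_mul_realUMatrix (l : ℕ) : (realUMatrix l)ᴴ * realUMatrix l = 1 :=
  mul_eq_one_comm.1 (realUMatrix_mul_conjTranspose l)

/-- The components with respect to the complex spherical harmonics of a tensor given by its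
components with respect to the real ones. -/
def complexComp (l : ℕ) : (Order l → ℂ) →ₗ[ℂ] (Order l → ℂ) := (realUMatrix l)ᵀ.mulVecLin

theorem complexComp_apply {l : ℕ} (A : Order l → ℂ) (m : Order l) :
    complexComp l A m = ∑ μ : Order l, realU μ m * A μ := rfl

theorem complexComp_star_mulVec {l : ℕ} (a : Order l → ℂ) :
    complexComp l (fun μ : Order l => ∑ m : Order l, star (realU μ m) * a m) = a := by
  have h : (fun μ : Order l => ∑ m : Order l, star (realU μ m) * a m) =
      (realUMatrix l)ᴴᵀ *ᵥ a := rfl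
  rw [h, complexComp, Matrix.mulVecLin_apply, Matrix.mulVec_mulVec, ← Matrix.transpose_mul,
    conjTranspose_mul_realUMatrix, Matrix.transpose_one, Matrix.one_mulVec]

theorem complexComp_injective (l : ℕ) : Function.Injective (complexComp l) := by
  have h : (realUMatrix l)ᴴᵀ * (realUMatrix l)ᵀ = 1 := by
    rw [← Matrix.transpose_mul, realUMatrix_mul_conjTranspose, Matrix.transpose_one]
  intro A B hAB
  have := congrArg ((realUMatrix l)ᴴᵀ *ᵥ ·) hAB
  simpa only [complexComp, Matrix.mulVecLin_apply, Matrix.mulVec_mulVec, h, Matrix.one_mulVec]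
    using this

/-- The factor `star (realU μ m)` in `realCG` is undone by unitarity, and the other two factors are
absorbed in the components of `A` and `B`. All later computations can therefore use the complex
coefficients. -/
theorem complexComp_contract {l₁ l₂ : ℕ} (L : ℕ) (A : Order l₁ → ℂ) (B : Order l₂ → ℂ)
    (M : Order L) :
    complexComp L (contract L A B) M = ∑ m₁ : Order l₁, ∑ m₂ : Order l₂,
      (clebschGordan l₁ l₂ L m₁ m₂ M : ℂ) * (complexComp l₁ A m₁ * complexComp l₂ B m₂) := by
  have h : contract L A B = fun μ : Order L => ∑ m : Order L, star (realU μ m) *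
      ∑ m₁ : Order l₁, ∑ m₂ : Order l₂,
      (clebschGordan l₁ l₂ L m₁ m₂ m : ℂ) * (complexComp l₁ A m₁ * complexComp l₂ B m₂) := by
    funext μ
    simp only [contract, realCG, complexComp_apply, Finset.mul_sum,
      Finset.sum_mul]
    simp only [← Finset.sum_product', Finset.univ_product_univ]
    refine Fintype.sum_equiv
      (⟨fun x => (x.2.2.1, x.2.2.2.1, x.2.2.2.2, x.2.1, x.1),
        fun y => (y.2.2.2.2, y.2.2.2.1, y.1, y.2.1, y.2.2.1), fun _ => rfl, fun _ => rfl⟩ :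
        Order l₁ × Order l₂ × Order L × Order l₁ × Order l₂ ≃
          Order L × Order l₁ × Order l₂ × Order l₂ × Order l₁) _ _ ?_
    intro x
    simp only [Equiv.coe_fn_mk]
    ring
  rw [h, complexComp_star_mulVec]

theorem complexComp_realWignerD {l : ℕ} (α β γ : ℝ) (A : Order l → ℂ) (m : Order l) :
    complexComp l (realWignerD l α β γ *ᵥ A) m =
      ∑ m' : Order l, wignerD l α β γ m m' * complexComp l A m' := by
  have h : realWignerD l α β γ *ᵥ A = fun μ : Order l => ∑ m : Order l, star (realU μ m) *
      ∑ m' : Order l, wignerD l α β γ m m' * complexComp l A m' := by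
    funext μ
    simp only [Matrix.mulVec, dotProduct, realWignerD, Matrix.of_apply, complexComp_apply,
      Finset.mul_sum, Finset.sum_mul]
    simp only [← Finset.sum_product', Finset.univ_product_univ]
    refine Fintype.sum_equiv
      ⟨fun x => (x.2.1, x.2.2, x.1), fun y => (y.2.2, y.1, y.2.1), fun _ => rfl,
        fun _ => rfl⟩ _ _ ?_
    intro x
    simp only [Equiv.coe_fn_mk]
    ring
  rw [h, complexComp_star_mulVec]

/-! ### Binary forms and maximal contraction. -/

/-- The square root of the binomial coefficient `(2l choose l + m)`. -/
def formWeight (l : ℕ) (m : ℤ) : ℝ := Real.sqrt ((2 * l)! / (fac (l + m) * fac (l - m)))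

theorem formWeight_pos (l : ℕ) (m : ℤ) : 0 < formWeight l m := by
  have := fac_pos (l + m)
  have := fac_pos (l - m)
  unfold formWeight; positivity

theorem formWeight_sq (l : ℕ) (m : ℤ) :
    formWeight l m ^ 2 = (2 * l)! / (fac (l + m) * fac (l - m)) := by
  have := fac_pos (l + m)
  have := fac_pos (l - m)
  exact Real.sq_sqrt (by positivity)

theorem formWeight_neg (l : ℕ) (m : ℤ) : formWeight l (-m) = formWeight l m := by
  unfold formWeight
  rw [mul_comm (fac _), sub_neg_eq_add, ← sub_eq_add_neg]

/-- The binary form of degree `2l` with the given complex components; `u ^ (l + m) * v ^ (l - m)`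
spans the weight space of order `m`. -/
def binaryForm (l : ℕ) : (Order l → ℂ) →ₗ[ℂ] (ℂ → ℂ → ℂ) where
  toFun a u v := ∑ m : Order l,
    a m * (formWeight l m * (u ^ ((l : ℤ) + m).toNat * v ^ ((l : ℤ) - m).toNat))
  map_add' a b := by
    funext u v
    simp [add_mul, Finset.sum_add_distrib]
  map_smul' c a := by
    funext u v
    simp [Finset.mul_sum, mul_assoc]

theorem binaryForm_apply {l : ℕ} (a : Order l → ℂ) (u v : ℂ) :
    binaryForm l a u v = ∑ m : Order l,
      a m * (formWeight l m * (u ^ ((l : ℤ) + m).toNat * v ^ ((l : ℤ) - m).toNat)) := rfl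

/-- At `v = 1` distinct orders give distinct powers of `u`. -/
theorem binaryForm_injective (l : ℕ) : Function.Injective (binaryForm l) := by
  rw [injective_iff_map_eq_zero]
  intro a ha
  have h : (∑ m : Order l, Polynomial.monomial ((l : ℤ) + m).toNat (a m * formWeight l m)) = 0 := by
    refine Polynomial.funext fun u => ?_
    have := congrFun (congrFun ha u) 1
    rw [binaryForm_apply] at this
    rw [Polynomial.eval_finsetSum, Polynomial.eval_zero]
    simpa [Polynomial.eval_monomial, mul_assoc] using this
  funext m
  have h2 := congrArg (fun p => p.coeff ((l : ℤ) + m).toNat) h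
  simp only [Polynomial.finsetSum_coeff, Polynomial.coeff_monomial, Polynomial.coeff_zero] at h2
  rw [Finset.sum_eq_single m] at h2
  · simpa [(formWeight_pos l m).ne'] using h2
  · intro m' _ hne
    have := m.neg_le
    have := m'.neg_le
    have : (m' : ℤ) ≠ m := fun e => hne (Subtype.ext e)
    rw [if_neg (by omega)]
  · simp

/-- In top degree the factor `1 / (l₁ + l₂ - L - k)!` kills every term of Racah's sum except `k =
0`. The remaining product is a ratio of weights, which is why `formWeight` is the normalization that
turns contraction into multiplication. -/
theorem clebschGordan_add (l₁ l₂ : ℕ) (m₁ : Order l₁) (m₂ : Order l₂) (M : ℤ) :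
    clebschGordan l₁ l₂ (l₁ + l₂) m₁ m₂ M = if (m₁ : ℤ) + m₂ = M then
      formWeight l₁ m₁ * formWeight l₂ m₂ / formWeight (l₁ + l₂) M else 0 := by
  have h₁ := m₁.le
  have h₁' := m₁.neg_le
  have h₂ := m₂.le
  have h₂' := m₂.neg_le
  unfold clebschGordan
  by_cases hM : (m₁ : ℤ) + m₂ = M
  swap
  · simp [hM]
  rw [if_pos ⟨hM, by push_cast; rw [abs_le]; omega, le_rfl⟩, if_pos hM,
    Finset.sum_eq_single 0]
  rotate_left
  · intro k _ hk
    rw [invFac_of_neg (k := (l₁ : ℤ) + l₂ - (l₁ + l₂ : ℕ) - k) (by push_cast; omega)]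
    simp
  · simp
  have e1 : ((l₁ + l₂ : ℕ) : ℤ) + l₁ - l₂ = (2 * l₁ : ℕ) := by push_cast; ring
  have e2 : ((l₁ + l₂ : ℕ) : ℤ) - l₁ + l₂ = (2 * l₂ : ℕ) := by push_cast; ring
  have e3 : (l₁ : ℤ) + l₂ - (l₁ + l₂ : ℕ) = (0 : ℕ) := by push_cast; ring
  have e4 : (l₁ : ℤ) + l₂ + (l₁ + l₂ : ℕ) + 1 = (2 * (l₁ + l₂) + 1 : ℕ) := by push_cast; ring
  have e5 : ((l₁ + l₂ : ℕ) : ℤ) - l₂ + m₁ + (0 : ℕ) = l₁ + m₁ := by push_cast; ring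
  have e6 : ((l₁ + l₂ : ℕ) : ℤ) - l₁ - m₂ + (0 : ℕ) = l₂ - m₂ := by push_cast; ring
  rw [e1, e2, e3, e4, e5, e6]
  simp only [Nat.cast_zero, sub_zero]
  have z : invFac 0 = 1 := by simp [invFac]
  have z' : fac 0 = 1 := by simp [fac]
  rw [invFac_of_nonneg (k := l₁ - m₁) (by omega), invFac_of_nonneg (k := l₂ + m₂) (by omega),
    invFac_of_nonneg (k := l₁ + m₁) (by omega), invFac_of_nonneg (k := l₂ - m₂) (by omega),
    invFac_natCast, fac_natCast, fac_natCast, z, z']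
  have p1 := fac_pos (l₁ - m₁)
  have p2 := fac_pos (l₁ + m₁)
  have p3 := fac_pos (l₂ - m₂)
  have p4 := fac_pos (l₂ + m₂)
  have p5 := fac_pos ((l₁ + l₂ : ℕ) + M)
  have p6 := fac_pos ((l₁ + l₂ : ℕ) - M)
  have w1 := formWeight_pos l₁ m₁
  have w2 := formWeight_pos l₂ m₂
  have w3 := formWeight_pos (l₁ + l₂) M
  rw [← sq_eq_sq₀ (by positivity) (by positivity)]
  simp only [mul_pow, div_pow, formWeight_sq]
  rw [Real.sq_sqrt (by positivity), Real.sq_sqrt (by positivity), Nat.factorial_succ]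
  push_cast
  field_simp

theorem binaryForm_contract_add {l₁ l₂ : ℕ} (A : Order l₁ → ℂ) (B : Order l₂ → ℂ) :
    binaryForm (l₁ + l₂) (complexComp (l₁ + l₂) (contract (l₁ + l₂) A B)) =
      binaryForm l₁ (complexComp l₁ A) * binaryForm l₂ (complexComp l₂ B) := by
  funext u v
  simp only [Pi.mul_apply, binaryForm_apply, complexComp_contract, clebschGordan_add,
    Finset.sum_mul_sum]
  simp only [Finset.sum_mul]
  rw [Finset.sum_comm]
  refine Finset.sum_congr rfl fun m₁ _ => ?_
  rw [Finset.sum_comm]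
  refine Finset.sum_congr rfl fun m₂ _ => ?_
  have h₁ := m₁.le
  have h₁' := m₁.neg_le
  have h₂ := m₂.le
  have h₂' := m₂.neg_le
  have hM : (m₁ : ℤ) + m₂ ∈ Finset.Icc (-((l₁ + l₂ : ℕ) : ℤ)) (l₁ + l₂ : ℕ) := by
    rw [Finset.mem_Icc]; push_cast; omega
  rw [Finset.sum_eq_single ⟨_, hM⟩]
  · have e1 : (((l₁ + l₂ : ℕ) : ℤ) + (m₁ + m₂)).toNat =
        (l₁ + m₁ : ℤ).toNat + (l₂ + m₂ : ℤ).toNat := by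
      push_cast; omega
    have e2 : (((l₁ + l₂ : ℕ) : ℤ) - (m₁ + m₂)).toNat =
        (l₁ - m₁ : ℤ).toNat + (l₂ - m₂ : ℤ).toNat := by
      push_cast; omega
    have hw : (formWeight (l₁ + l₂) (m₁ + m₂) : ℂ) ≠ 0 := by
      exact_mod_cast (formWeight_pos _ _).ne'
    simp only [if_true, e1, e2, pow_add]
    push_cast
    field_simp
  · intro M _ hne
    rw [if_neg fun e => hne (Subtype.ext e.symm)]
    simp
  · simp

/-! ### Wigner matrices as linear substitutions. -/

theorem sum_formWeight_mul_smallD (l : ℕ) (m : Order l) (β : ℝ) (x y : ℂ) :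
    ∑ m' : Order l, (smallD l m' m β : ℂ) *
      (formWeight l m' * (x ^ ((l : ℤ) + m').toNat * y ^ ((l : ℤ) - m').toNat)) =
    formWeight l m *
      ((Real.cos (β / 2) * x + Real.sin (β / 2) * y) ^ ((l : ℤ) + m).toNat *
        (Real.cos (β / 2) * y - Real.sin (β / 2) * x) ^ ((l : ℤ) - m).toNat) := by
  have h₁ := m.le
  have h₁' := m.neg_le
  obtain ⟨p, hp⟩ := Int.eq_ofNat_of_zero_le (show 0 ≤ (l : ℤ) + m by omega)
  obtain ⟨q, hq⟩ := Int.eq_ofNat_of_zero_le (show 0 ≤ (l : ℤ) - m by omega)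
  rw [sum_order l fun m' => (smallD l m' m β : ℂ) *
    (formWeight l m' * (x ^ ((l : ℤ) + m').toNat * y ^ ((l : ℤ) - m').toNat))]
  simp only [smallD]
  generalize Real.cos (β / 2) = c
  generalize Real.sin (β / 2) = S
  rw [hp, hq, Int.toNat_natCast, Int.toNat_natCast, sub_eq_neg_add, add_comm ((c : ℂ) * x), add_pow,
    add_pow, Finset.sum_mul_sum, ← Finset.sum_product', Finset.mul_sum]
  simp only [Complex.ofReal_mul, Complex.ofReal_sum, Finset.mul_sum, Finset.sum_mul]
  rw [← Finset.sum_product']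
  symm
  -- Both powers on the right have been expanded by the binomial theorem. The term taking `s`
  -- factors `y` from the first and `k` factors `x` from the second contributes to order `m' = m - s
  -- + k`, and `s` is the index of Wigner's sum. Terms of Wigner's sum outside the image contain the
  -- reciprocal factorial of a negative integer.
  refine Finset.sum_of_injOn (fun z => ((m : ℤ) - z.1 + z.2, z.1)) ?_ ?_ ?_ ?_
  · rintro ⟨s, k⟩ - ⟨s', k'⟩ - h
    simp only [Prod.mk.injEq] at h ⊢
    omega
  · rintro ⟨s, k⟩ h
    simp only [Finset.coe_product, Finset.coe_range, Set.mem_prod, Set.mem_Iio, Finset.coe_Icc,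
      Set.mem_Icc] at h ⊢
    omega
  · rintro ⟨m', s⟩ - h
    have : p < s ∨ (m' - m + s) < 0 ∨ (l : ℤ) - m' - s < 0 := by
      by_contra hc
      push Not at hc
      refine h ⟨(s, (m' - m + s).toNat), ?_, ?_⟩
      · simp only [Finset.coe_product, Finset.coe_range, Set.mem_prod, Set.mem_Iio]
        omega
      · simp only [Prod.mk.injEq, and_true]
        omega
    rcases this with h | h | h
    · rw [invFac_of_neg (k := p - s) (by omega)]; simp
    · rw [invFac_of_neg h]; simp
    · rw [invFac_of_neg h]; simp
  · rintro ⟨s, k⟩ h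
    simp only [Finset.mem_product, Finset.mem_range] at h
    simp only
    have i1 : (m : ℤ) - s + k - m + s = k := by ring
    have i2 : (p : ℤ) - s = (p - s : ℕ) := by omega
    have i3 : (l : ℤ) - (m - s + k) - s = (q - k : ℕ) := by omega
    have i4 : (2 * l + m - (m - s + k) - 2 * s : ℤ).toNat = (p - s) + (q - k) := by omega
    have i5 : ((m : ℤ) - s + k - m + 2 * s).toNat = s + k := by omega
    have i6 : ((l : ℤ) + (m - s + k)).toNat = (p - s) + k := by omega
    have i7 : ((l : ℤ) - (m - s + k)).toNat = s + (q - k) := by omega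
    rw [i1, i2, i3, i4, i5, i6, i7]
    have hs : Real.sqrt (fac (l + (m - s + k)) * fac (l - (m - s + k)) * fac p * fac q) *
        formWeight l (m - s + k) = formWeight l m * p ! * q ! := by
      have p1 := fac_pos (l + (m - s + k))
      have p2 := fac_pos (l - (m - s + k))
      have p3 := formWeight_pos l (m - s + k)
      have p4 := formWeight_pos l m
      rw [fac_natCast, fac_natCast, ← sq_eq_sq₀ (by positivity) (by positivity)]
      simp only [mul_pow, formWeight_sq]
      rw [Real.sq_sqrt (by positivity), hp, hq, fac_natCast, fac_natCast]
      field_simp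
    have hs' := congrArg (fun t : ℝ => (t : ℂ)) hs
    simp only [invFac_natCast, zpow_natCast]
    rw [Nat.cast_choose ℂ (show s ≤ p by omega), Nat.cast_choose ℂ (show k ≤ q by omega)]
    push_cast at hs' ⊢
    simp only [pow_add, mul_pow, neg_pow (S * x : ℂ)]
    generalize x ^ (p - s) = x₁
    generalize y ^ (q - k) = y₁
    generalize (c : ℂ) ^ (p - s) = c₁
    generalize (c : ℂ) ^ (q - k) = c₂
    linear_combination (-((-1) ^ k * y ^ s * y₁ * x₁ * x ^ k * c₁ * c₂ * S ^ s * S ^ k *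
      (s ! : ℂ)⁻¹ * (k ! : ℂ)⁻¹ * ((p - s) ! : ℂ)⁻¹ * ((q - k) ! : ℂ)⁻¹)) * hs'

theorem exp_pow_mul_exp_pow {l : ℕ} (t : ℝ) (m : Order l) :
    Complex.exp (-Complex.I * (t / 2)) ^ ((l : ℤ) + m).toNat *
      Complex.exp (Complex.I * (t / 2)) ^ ((l : ℤ) - m).toNat =
    Complex.exp (-Complex.I * m * t) := by
  have h₁ := m.le
  have h₁' := m.neg_le
  rw [← Complex.exp_nat_mul, ← Complex.exp_nat_mul, ← Complex.exp_add]
  congr 1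
  have e1 : ((((l : ℤ) + m).toNat : ℤ) : ℂ) = l + m := by
    rw [Int.toNat_of_nonneg (by omega)]; push_cast; rfl
  have e2 : ((((l : ℤ) - m).toNat : ℤ) : ℂ) = l - m := by
    rw [Int.toNat_of_nonneg (by omega)]; push_cast; rfl
  rw [Int.cast_natCast] at e1 e2
  rw [e1, e2]
  ring

theorem binaryForm_realWignerD {l : ℕ} (α β γ : ℝ) (A : Order l → ℂ) (u v : ℂ) :
    binaryForm l (complexComp l (realWignerD l α β γ *ᵥ A)) u v =
      binaryForm l (complexComp l A)
        (Complex.exp (-Complex.I * (γ / 2)) *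
          (Real.cos (β / 2) * (Complex.exp (-Complex.I * (α / 2)) * u) +
            Real.sin (β / 2) * (Complex.exp (Complex.I * (α / 2)) * v)))
        (Complex.exp (Complex.I * (γ / 2)) *
          (Real.cos (β / 2) * (Complex.exp (Complex.I * (α / 2)) * v) -
            Real.sin (β / 2) * (Complex.exp (-Complex.I * (α / 2)) * u))) := by
  simp only [binaryForm_apply, complexComp_realWignerD, Finset.sum_mul]
  rw [Finset.sum_comm]
  refine Finset.sum_congr rfl fun m _ => ?_
  simp only [mul_pow]
  have h := sum_formWeight_mul_smallD l m β (Complex.exp (-Complex.I * (α / 2)) * u)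
    (Complex.exp (Complex.I * (α / 2)) * v)
  rw [mul_mul_mul_comm, exp_pow_mul_exp_pow γ m, mul_left_comm (formWeight l m : ℂ), ← h,
    Finset.mul_sum, Finset.mul_sum]
  refine Finset.sum_congr rfl fun m' _ => ?_
  simp only [mul_pow]
  rw [mul_mul_mul_comm (Complex.exp (-Complex.I * (α / 2)) ^ _), exp_pow_mul_exp_pow α m', wignerD]
  ring

/-! ### Degree one: vectors, cross products and rotations. -/

theorem sum_order_one {M : Type*} [AddCommMonoid M] (f : ℤ → M) :
    ∑ m : Order 1, f m = f (-1) + (f 0 + f 1) := by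
  rw [sum_order 1 f, show Finset.Icc (-((1 : ℕ) : ℤ)) (1 : ℕ) = {-1, 0, 1} by decide,
    Finset.sum_insert (by decide), Finset.sum_insert (by decide), Finset.sum_singleton]

theorem Order.eq_one_cases (m : Order 1) : (m : ℤ) = -1 ∨ (m : ℤ) = 0 ∨ (m : ℤ) = 1 := by
  have := m.le
  have := m.neg_le
  push_cast at *
  omega

/-- The components of a vector with respect to the complex spherical harmonics of degree one. -/
def vecComp (a : Fin 3 → ℝ) (m : ℤ) : ℂ :=
  if m = 0 then (a 2 : ℂ) else if m < 0 then (a 0 + Complex.I * a 1) / (Real.sqrt 2 : ℂ)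
    else (-a 0 + Complex.I * a 1) / (Real.sqrt 2 : ℂ)

theorem complexComp_ofVec (a : Fin 3 → ℝ) (m : Order 1) :
    complexComp 1 (ofVec a) m = vecComp a m := by
  rw [complexComp_apply]
  unfold ofVec
  rw [sum_order_one fun μ => realU μ m *
    if μ = -1 then (a 0 : ℂ) else if μ = 0 then (a 2 : ℂ) else (a 1 : ℂ)]
  rcases m.eq_one_cases with h | h | h <;> rw [h] <;> simp [realU, vecComp] <;> ring

theorem formWeight_one_zero : formWeight 1 0 = Real.sqrt 2 := by
  simp [formWeight, fac, Nat.factorial]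

theorem formWeight_one_one : formWeight 1 1 = 1 := by
  have h : fac (((1 : ℕ) : ℤ) + 1) = 2 := fac_natCast 2
  have h' : fac (((1 : ℕ) : ℤ) - 1) = 1 := by simp [fac]
  rw [formWeight, h, h']
  norm_num [Nat.factorial]

theorem binaryForm_ofVec (a : Fin 3 → ℝ) (u v : ℂ) :
    binaryForm 1 (complexComp 1 (ofVec a)) u v = ((-a 0 + Complex.I * a 1) * u ^ 2 +
      2 * a 2 * (u * v) + (a 0 + Complex.I * a 1) * v ^ 2) / (Real.sqrt 2 : ℂ) := by
  rw [binaryForm_apply]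
  simp only [complexComp_ofVec]
  rw [sum_order_one fun m => vecComp a m *
    (formWeight 1 m * (u ^ (((1 : ℕ) : ℤ) + m).toNat * v ^ (((1 : ℕ) : ℤ) - m).toNat)),
    formWeight_neg, formWeight_one_one, formWeight_one_zero]
  have h0 := ofReal_sqrt_two_ne
  have h2 := ofReal_sqrt_two_sq
  simp [vecComp]
  field_simp
  linear_combination (a 2 * u * v : ℂ) * h2

theorem clebschGordan_one (m₁ m₂ M : Order 1) : clebschGordan 1 1 1 m₁ m₂ M =
    if (m₁ : ℤ) + m₂ = M then (m₁ - m₂ : ℤ) * (if (M : ℤ) = 0 then 1 / 2 else 1) / Real.sqrt 2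
      else 0 := by
  -- The root of 8 comes from Racah's prefactor, which is `√(3 / 4!) = 1 / √8` when all degrees are
  -- one.
  have h8 : (Real.sqrt 8)⁻¹ * 2 = (Real.sqrt 2)⁻¹ := by
    rw [show (8 : ℝ) = 2 * 2 ^ 2 by norm_num, Real.sqrt_mul (by norm_num),
      Real.sqrt_sq (by norm_num)]
    field_simp
  have t2 : Int.toNat 2 = 2 := rfl
  have t4 : Int.toNat 4 = 4 := rfl
  have h4 : Real.sqrt 4 = 2 := by
    rw [show (4 : ℝ) = 2 ^ 2 by norm_num, Real.sqrt_sq (by norm_num)]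
  unfold clebschGordan
  rcases m₁.eq_one_cases with h₁ | h₁ | h₁ <;> rcases m₂.eq_one_cases with h₂ | h₂ | h₂ <;>
    rcases M.eq_one_cases with h | h | h <;> rw [h₁, h₂, h] <;>
    norm_num [Finset.sum_range_succ, fac, invFac, Nat.factorial, h4, t2, t4] <;>
    first | exact h8 | (rw [h8]; ring)

theorem contract_one_ofVec (a b : Fin 3 → ℝ) :
    contract 1 (ofVec a) (ofVec b) =
      (-Complex.I / (Real.sqrt 2 : ℂ)) • ofVec (crossProduct a b) := by
  apply complexComp_injective
  funext M
  have h0 := ofReal_sqrt_two_ne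
  have h2 := ofReal_sqrt_two_sq
  rw [map_smul, Pi.smul_apply, complexComp_ofVec, complexComp_contract]
  simp only [clebschGordan_one, complexComp_ofVec]
  have h := sum_order_one fun m₁ => ∑ m₂ : Order 1, (((if m₁ + m₂ = M then (m₁ - m₂ : ℤ) *
    (if (M : ℤ) = 0 then 1 / 2 else 1) / Real.sqrt 2 else 0 : ℝ) : ℂ) *
      (vecComp a m₁ * vecComp b m₂))
  have h' := fun m₁ : ℤ => sum_order_one fun m₂ => (((if m₁ + m₂ = M then (m₁ - m₂ : ℤ) *
    (if (M : ℤ) = 0 then 1 / 2 else 1) / Real.sqrt 2 else 0 : ℝ) : ℂ) *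
      (vecComp a m₁ * vecComp b m₂))
  rw [h, h', h', h']
  rcases M.eq_one_cases with hM | hM | hM <;> rw [hM] <;>
    simp [vecComp, cross_apply] <;> field_simp
  · linear_combination (a 2 * b 0 - a 0 * b 2 : ℂ) * Complex.I_sq
  · linear_combination (Complex.I * (a 0 * b 1 - a 1 * b 0) : ℂ) * h2
  · linear_combination (a 2 * b 0 - a 0 * b 2 : ℂ) * Complex.I_sq

theorem rotZ_mulVec (t : ℝ) (a : Fin 3 → ℝ) : rotZ t *ᵥ a =
    ![Real.cos t * a 0 - Real.sin t * a 1, Real.sin t * a 0 + Real.cos t * a 1, a 2] := by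
  funext i
  fin_cases i <;> simp [rotZ, Matrix.mulVec, dotProduct, Fin.sum_univ_three] ; ring

theorem rotY_mulVec (t : ℝ) (a : Fin 3 → ℝ) : rotY t *ᵥ a =
    ![Real.cos t * a 0 + Real.sin t * a 2, a 1, -Real.sin t * a 0 + Real.cos t * a 2] := by
  funext i
  fin_cases i <;> simp [rotY, Matrix.mulVec, dotProduct, Fin.sum_univ_three]

theorem rotZ_mulVec_cross (t : ℝ) (a b : Fin 3 → ℝ) :
    rotZ t *ᵥ crossProduct a b = crossProduct (rotZ t *ᵥ a) (rotZ t *ᵥ b) := by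
  rw [rotZ_mulVec, rotZ_mulVec, rotZ_mulVec, cross_apply, cross_apply]
  have h := Real.sin_sq_add_cos_sq t
  funext i
  fin_cases i <;> simp
  · ring
  · ring
  · linear_combination (a 1 * b 0 - a 0 * b 1) * h

theorem rotY_mulVec_cross (t : ℝ) (a b : Fin 3 → ℝ) :
    rotY t *ᵥ crossProduct a b = crossProduct (rotY t *ᵥ a) (rotY t *ᵥ b) := by
  rw [rotY_mulVec, rotY_mulVec, rotY_mulVec, cross_apply, cross_apply]
  have h := Real.sin_sq_add_cos_sq t
  funext i
  fin_cases i <;> simp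
  · ring
  · linear_combination (a 0 * b 2 - a 2 * b 0) * h
  · ring

theorem rotation_mulVec (α β γ : ℝ) (a : Fin 3 → ℝ) :
    rotation α β γ *ᵥ a = rotZ α *ᵥ (rotY β *ᵥ (rotZ γ *ᵥ a)) := by
  simp [rotation, Matrix.mulVec_mulVec, Matrix.mul_assoc]

theorem rotation_mulVec_cross (α β γ : ℝ) (a b : Fin 3 → ℝ) :
    rotation α β γ *ᵥ crossProduct a b =
      crossProduct (rotation α β γ *ᵥ a) (rotation α β γ *ᵥ b) := by
  simp only [rotation_mulVec, rotZ_mulVec_cross, rotY_mulVec_cross]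

theorem rotZ_mem_orthogonalGroup (t : ℝ) : rotZ t ∈ Matrix.orthogonalGroup (Fin 3) ℝ := by
  rw [Matrix.mem_orthogonalGroup_iff]
  have h := Real.sin_sq_add_cos_sq t
  ext i j
  fin_cases i <;> fin_cases j <;>
    simp [rotZ, Matrix.mul_apply, Fin.sum_univ_three] <;>
    first | linear_combination h | ring

theorem rotY_mem_orthogonalGroup (t : ℝ) : rotY t ∈ Matrix.orthogonalGroup (Fin 3) ℝ := by
  rw [Matrix.mem_orthogonalGroup_iff]
  have h := Real.sin_sq_add_cos_sq t
  ext i j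
  fin_cases i <;> fin_cases j <;>
    simp [rotY, Matrix.mul_apply, Fin.sum_univ_three] <;>
    first | linear_combination h | ring

theorem rotation_mem_orthogonalGroup (α β γ : ℝ) :
    rotation α β γ ∈ Matrix.orthogonalGroup (Fin 3) ℝ :=
  mul_mem (mul_mem (rotZ_mem_orthogonalGroup α) (rotY_mem_orthogonalGroup β))
    (rotZ_mem_orthogonalGroup γ)

theorem neg_rotation_mem_orthogonalGroup (α β γ : ℝ) :
    -rotation α β γ ∈ Matrix.orthogonalGroup (Fin 3) ℝ := by
  have h := rotation_mem_orthogonalGroup α β γ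
  rw [Matrix.mem_orthogonalGroup_iff] at h ⊢
  change -rotation α β γ * (-rotation α β γ)ᵀ = 1
  change rotation α β γ * (rotation α β γ)ᵀ = 1 at h
  rw [Matrix.transpose_neg, neg_mul_neg, h]

theorem rotation_mulVec_transpose_mulVec (α β γ : ℝ) (a : Fin 3 → ℝ) :
    rotation α β γ *ᵥ ((rotation α β γ)ᵀ *ᵥ a) = a := by
  have h : rotation α β γ * (rotation α β γ)ᵀ = 1 :=
    (Matrix.mem_orthogonalGroup_iff _ _).1 (rotation_mem_orthogonalGroup α β γ)
  rw [Matrix.mulVec_mulVec, h, Matrix.one_mulVec]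

/-- Spherical coordinates: every vector is a rotated multiple of the third basis vector. -/
theorem exists_rotation_mulVec_eq (w : Fin 3 → ℝ) :
    ∃ α β ρ : ℝ, w = rotation α β 0 *ᵥ ![0, 0, ρ] := by
  -- The argument of `z₁` is the azimuth. The argument of `z₂`, formed from the height and the
  -- distance to the axis, is the polar angle.
  let z₁ : ℂ := ⟨w 0, w 1⟩
  let z₂ : ℂ := ⟨w 2, ‖z₁‖⟩
  refine ⟨z₁.arg, z₂.arg, ‖z₂‖, ?_⟩
  have h1 := Complex.norm_mul_cos_arg z₁
  have h2 := Complex.norm_mul_sin_arg z₁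
  have h3 := Complex.norm_mul_cos_arg z₂
  have h4 := Complex.norm_mul_sin_arg z₂
  change _ = w 0 at h1
  change _ = w 1 at h2
  change _ = w 2 at h3
  change _ = ‖z₁‖ at h4
  rw [rotation_mulVec, rotZ_mulVec, rotY_mulVec, rotZ_mulVec]
  funext i
  fin_cases i <;> simp
  · rw [← h1, ← h4]; ring
  · rw [← h2, ← h4]; ring
  · rw [← h3]; ring

/-! ### Equivariance of the couplings. -/

/-- The binary form of a tensor given by its components with respect to the real harmonics. -/
def tensorForm (l : ℕ) : (Order l → ℂ) →ₗ[ℂ] (ℂ → ℂ → ℂ) := binaryForm l ∘ₗ complexComp l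

theorem tensorForm_injective (l : ℕ) : Function.Injective (tensorForm l) :=
  (binaryForm_injective l).comp (complexComp_injective l)

theorem tensorForm_contract_add {l₁ l₂ : ℕ} (A : Order l₁ → ℂ) (B : Order l₂ → ℂ) :
    tensorForm (l₁ + l₂) (contract (l₁ + l₂) A B) = tensorForm l₁ A * tensorForm l₂ B :=
  binaryForm_contract_add A B

theorem tensorForm_ofVec (a : Fin 3 → ℝ) (u v : ℂ) :
    tensorForm 1 (ofVec a) u v = ((-a 0 + Complex.I * a 1) * u ^ 2 +
      2 * a 2 * (u * v) + (a 0 + Complex.I * a 1) * v ^ 2) / (Real.sqrt 2 : ℂ) :=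
  binaryForm_ofVec a u v

theorem tensorForm_realWignerD {l : ℕ} (α β γ : ℝ) (A : Order l → ℂ) (u v : ℂ) :
    tensorForm l (realWignerD l α β γ *ᵥ A) u v =
      tensorForm l A
        (Complex.exp (-Complex.I * (γ / 2)) *
          (Real.cos (β / 2) * (Complex.exp (-Complex.I * (α / 2)) * u) +
            Real.sin (β / 2) * (Complex.exp (Complex.I * (α / 2)) * v)))
        (Complex.exp (Complex.I * (γ / 2)) *
          (Real.cos (β / 2) * (Complex.exp (Complex.I * (α / 2)) * v) -
            Real.sin (β / 2) * (Complex.exp (-Complex.I * (α / 2)) * u))) :=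
  binaryForm_realWignerD α β γ A u v

theorem tensorForm_ofVec_rotZ (t : ℝ) (a : Fin 3 → ℝ) (u v : ℂ) :
    tensorForm 1 (ofVec (rotZ t *ᵥ a)) u v = tensorForm 1 (ofVec a)
      (Complex.exp (-Complex.I * (t / 2)) * u) (Complex.exp (Complex.I * (t / 2)) * v) := by
  have e1 : Complex.exp (-Complex.I * (t / 2)) ^ 2 = Complex.cos t - Complex.sin t * Complex.I := by
    rw [← Complex.exp_nat_mul, show ((2 : ℕ) : ℂ) * (-Complex.I * (t / 2)) = (-t : ℂ) * Complex.I by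
      push_cast; ring, Complex.exp_mul_I, Complex.cos_neg, Complex.sin_neg]
    ring
  have e2 : Complex.exp (Complex.I * (t / 2)) ^ 2 = Complex.cos t + Complex.sin t * Complex.I := by
    rw [← Complex.exp_nat_mul, ← Complex.exp_mul_I]
    congr 1; push_cast; ring
  have e3 : Complex.exp (-Complex.I * (t / 2)) * Complex.exp (Complex.I * (t / 2)) = 1 := by
    rw [← Complex.exp_add, neg_mul, neg_add_cancel, Complex.exp_zero]
  rw [tensorForm_ofVec, tensorForm_ofVec, rotZ_mulVec, mul_mul_mul_comm (Complex.exp _), e3, mul_pow,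
    mul_pow, e1, e2]
  congr 1
  simp
  have hI := Complex.I_sq
  linear_combination (a 1 * Complex.sin t * (u ^ 2 - v ^ 2)) * hI

theorem tensorForm_ofVec_rotY (t : ℝ) (a : Fin 3 → ℝ) (u v : ℂ) :
    tensorForm 1 (ofVec (rotY t *ᵥ a)) u v = tensorForm 1 (ofVec a)
      (Real.cos (t / 2) * u + Real.sin (t / 2) * v)
      (Real.cos (t / 2) * v - Real.sin (t / 2) * u) := by
  have hc : Real.cos t = 2 * Real.cos (t / 2) ^ 2 - 1 := by
    rw [← Real.cos_two_mul]; ring_nf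
  have hs : Real.sin t = 2 * Real.sin (t / 2) * Real.cos (t / 2) := by
    rw [← Real.sin_two_mul]; ring_nf
  have h : (Real.sin (t / 2) : ℂ) ^ 2 + (Real.cos (t / 2) : ℂ) ^ 2 = 1 := by
    exact_mod_cast Real.sin_sq_add_cos_sq (t / 2)
  rw [tensorForm_ofVec, tensorForm_ofVec, rotY_mulVec, hc, hs]
  generalize Real.cos (t / 2) = c at *
  generalize Real.sin (t / 2) = s at *
  congr 1
  simp
  linear_combination (a 0 * (v ^ 2 - u ^ 2) + 2 * a 2 * u * v -
    Complex.I * a 1 * (u ^ 2 + v ^ 2) : ℂ) * h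

/-- The three elementary rotations act on quadratic forms by half-angle substitutions, whose
composite is the substitution of the Wigner matrix. -/
theorem realWignerD_mulVec_ofVec (α β γ : ℝ) (a : Fin 3 → ℝ) :
    realWignerD 1 α β γ *ᵥ ofVec a = ofVec (rotation α β γ *ᵥ a) := by
  apply tensorForm_injective
  funext u v
  rw [tensorForm_realWignerD, rotation_mulVec, tensorForm_ofVec_rotZ, tensorForm_ofVec_rotY,
    tensorForm_ofVec_rotZ]

/-- A substitution into a product of forms is the product of the substitutions. -/
theorem realWignerD_mulVec_contract_add {l₁ l₂ : ℕ} (α β γ : ℝ) (A : Order l₁ → ℂ)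
    (B : Order l₂ → ℂ) :
    realWignerD (l₁ + l₂) α β γ *ᵥ contract (l₁ + l₂) A B =
      contract (l₁ + l₂) (realWignerD l₁ α β γ *ᵥ A) (realWignerD l₂ α β γ *ᵥ B) := by
  apply tensorForm_injective
  funext u v
  rw [tensorForm_realWignerD, tensorForm_contract_add, tensorForm_contract_add, Pi.mul_apply,
    Pi.mul_apply, Pi.mul_apply, Pi.mul_apply, tensorForm_realWignerD, tensorForm_realWignerD]

theorem realWignerD_mulVec_pseudoMaximal (α β γ : ℝ) (l : ℕ) (a : Fin (l + 1) → Fin 3 → ℝ) :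
    realWignerD l α β γ *ᵥ pseudoMaximal l a =
      pseudoMaximal l fun j => rotation α β γ *ᵥ a j := by
  match l, a with
  | 0, _ => simp [pseudoMaximal]
  | 1, a =>
    simp only [pseudoMaximal, contract_one_ofVec]
    rw [Matrix.mulVec_smul, realWignerD_mulVec_ofVec, rotation_mulVec_cross]
  | l + 2, a =>
    simp only [pseudoMaximal]
    rw [realWignerD_mulVec_contract_add (l₁ := l + 1) (l₂ := 1), realWignerD_mulVec_ofVec,
      realWignerD_mulVec_pseudoMaximal]

/-! ### Reality of the couplings. -/

theorem star_realU {l : ℕ} (μ m : Order l) :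
    star (realU μ m) = (-1) ^ (m : ℤ).natAbs * realU μ (-m) := by
  have hs : ((-1 : ℂ) ^ (m : ℤ).natAbs) * (-1 : ℂ) ^ (m : ℤ).natAbs = 1 := by
    rw [← mul_pow]; simp
  generalize (m : ℤ) = k at *
  generalize (μ : ℤ) = p at *
  unfold realU
  rcases lt_trichotomy p 0 with h | h | h
  · have h1 : p ≠ 0 := by omega
    by_cases hk : k = p
    · subst hk
      have : -k ≠ k := by omega
      simp [h, h1, this, ← mul_div_assoc, hs]
    · by_cases hk' : p = -k
      · subst hk'
        have : -k ≠ k := by omega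
        have : k ≠ -k := by omega
        simp_all [div_eq_mul_inv]
      · have : -k ≠ p := by omega
        have hk' : k ≠ -p := by omega
        simp [h, h1, hk, hk', this]
  · subst h; by_cases hk : k = 0 <;> simp [hk]
  · have h1 : p ≠ 0 := by omega
    have h0 : ¬ p < 0 := by omega
    by_cases hk : k = p
    · subst hk
      have : k ≠ -k := by omega
      simp [h0, h1, this]; ring
    · by_cases hk' : p = -k
      · subst hk'
        have : -k ≠ k := by omega
        have : k ≠ -k := by omega
        have h0' : ¬ 0 < k := by omega
        have h1' : k ≠ 0 := by omega
        have h2' : -k ≠ k := by omega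
        simp [h0', h1', h2']
        linear_combination (Complex.I / Real.sqrt 2 : ℂ) * hs
      · have : -k ≠ p := by omega
        have hk' : k ≠ -p := by omega
        simp [h0, h1, hk, hk', this]

/-- Reflection `m ↦ -m` of the orders. -/
def negOrder (l : ℕ) : Order l ≃ Order l where
  toFun m := ⟨-m, by have := Finset.mem_Icc.1 m.2; rw [Finset.mem_Icc]; omega⟩
  invFun m := ⟨-m, by have := Finset.mem_Icc.1 m.2; rw [Finset.mem_Icc]; omega⟩
  left_inv m := by simp
  right_inv m := by simp

theorem coe_negOrder {l : ℕ} (m : Order l) : (negOrder l m : ℤ) = -m := rfl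

/-- Conjugation reverses the signs of all three orders. The top-degree Clebsch–Gordan coefficients
are invariant under this, and the signs cancel because `m₁ + m₂ = m`. -/
theorem star_realCG_add {l₁ l₂ : ℕ} (μ₁ : Order l₁) (μ₂ : Order l₂) (μ : Order (l₁ + l₂)) :
    star (realCG l₁ l₂ (l₁ + l₂) μ₁ μ₂ μ) = realCG l₁ l₂ (l₁ + l₂) μ₁ μ₂ μ := by
  simp only [realCG, star_sum]
  refine Fintype.sum_equiv (negOrder _) _ _ fun m => ?_
  refine Fintype.sum_equiv (negOrder _) _ _ fun m₁ => ?_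
  refine Fintype.sum_equiv (negOrder _) _ _ fun m₂ => ?_
  rw [star_mul', star_mul', star_mul', star_realU μ₁, star_realU μ₂, star_realU μ (negOrder _ m)]
  simp only [clebschGordan_add]
  simp only [coe_negOrder, star_star, neg_neg, formWeight_neg, Int.natAbs_neg]
  by_cases h : (m₁ : ℤ) + m₂ = m
  · have h' : -(m₁ : ℤ) + -m₂ = -m := by omega
    have hs : ((-1 : ℂ) ^ (m₁ : ℤ).natAbs * (-1) ^ (m₂ : ℤ).natAbs) = (-1) ^ (m : ℤ).natAbs := by
      rw [← pow_add]
      rcases Nat.even_or_odd (m : ℤ).natAbs with he | he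
      · rw [he.neg_one_pow, Even.neg_one_pow]
        rw [Nat.even_iff] at he ⊢; omega
      · rw [he.neg_one_pow, Odd.neg_one_pow]
        rw [Nat.odd_iff] at he ⊢; omega
    simp only [h, h', if_true, Complex.star_def, Complex.conj_ofReal]
    rw [← hs]
    ring
  · have h' : ¬ -(m₁ : ℤ) + -m₂ = -m := by omega
    simp [h, h']

theorem contract_add_toComplex {l₁ l₂ : ℕ} (A : Order l₁ → ℝ) (B : Order l₂ → ℝ) :
    ∃ T, contract (l₁ + l₂) (toComplex A) (toComplex B) = toComplex T := by
  refine ⟨fun μ => (contract (l₁ + l₂) (toComplex A) (toComplex B) μ).re, ?_⟩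
  funext μ
  have : (starRingEnd ℂ) (contract (l₁ + l₂) (toComplex A) (toComplex B) μ) =
      contract (l₁ + l₂) (toComplex A) (toComplex B) μ := by
    simp only [contract, map_sum, map_mul, toComplex, Complex.conj_ofReal]
    simp only [← Complex.star_def, star_realCG_add]
  exact (Complex.conj_eq_iff_re.1 this).symm

theorem contract_smul {l₁ l₂ : ℕ} (L : ℕ) (c : ℂ) (A : Order l₁ → ℂ) (B : Order l₂ → ℂ) :
    contract L (c • A) B = c • contract L A B := by
  funext μ
  simp only [contract, Pi.smul_apply, smul_eq_mul, Finset.mul_sum]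
  exact Finset.sum_congr rfl fun _ _ => Finset.sum_congr rfl fun _ _ => by ring

/-- The real components of a vector in the order of the harmonics of degree one. -/
def ofVecReal (a : Fin 3 → ℝ) : Order 1 → ℝ :=
  fun μ => if (μ : ℤ) = -1 then a 0 else if (μ : ℤ) = 0 then a 2 else a 1

theorem ofVec_eq_toComplex (a : Fin 3 → ℝ) : ofVec a = toComplex (ofVecReal a) := by
  funext μ
  simp only [ofVec, toComplex, ofVecReal]
  split_ifs <;> rfl

/-- The innermost contraction contributes the only imaginary factor, `-i/√2`; all outer ones are
maximal and so preserve reality. -/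
theorem exists_I_smul_pseudoMaximal (l : ℕ) (a : Fin (l + 1) → Fin 3 → ℝ) :
    ∃ T, Complex.I • pseudoMaximal l a = toComplex T := by
  match l, a with
  | 0, _ => exact ⟨0, by funext; simp [pseudoMaximal, toComplex]⟩
  | 1, a =>
    refine ⟨(1 / Real.sqrt 2) • ofVecReal (crossProduct (a 0) (a 1)), ?_⟩
    rw [pseudoMaximal, contract_one_ofVec, ofVec_eq_toComplex, smul_smul]
    funext μ
    simp [toComplex, mul_div_assoc', Complex.I_mul_I]
  | l + 2, a =>
    obtain ⟨T, hT⟩ := exists_I_smul_pseudoMaximal (l + 1) fun j => a j.castSucc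
    rw [pseudoMaximal, ← contract_smul, hT, ofVec_eq_toComplex]
    exact contract_add_toComplex (l₁ := l + 1) (l₂ := 1) _ _

/-! ### Monomials in the span of the couplings. -/

/-- The binary monomial `u ^ a * v ^ b`. -/
def monom (a b : ℕ) : ℂ → ℂ → ℂ := fun u v => u ^ a * v ^ b

theorem monom_mul (a b c d : ℕ) : monom a b * monom c d = monom (a + c) (b + d) := by
  funext u v
  simp only [monom, Pi.mul_apply, pow_add]
  ring

/-- The quadratic binary form of a vector. -/
def vecForm : (Fin 3 → ℝ) →ₗ[ℝ] (ℂ → ℂ → ℂ) where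
  toFun a := tensorForm 1 (ofVec a)
  map_add' a b := by
    funext u v
    simp only [Pi.add_apply, tensorForm_ofVec]
    push_cast
    ring
  map_smul' c a := by
    funext u v
    simp only [Pi.smul_apply, tensorForm_ofVec, smul_eq_mul, RingHom.id_apply, Complex.real_smul]
    push_cast
    ring

theorem vecForm_apply (a : Fin 3 → ℝ) : vecForm a = tensorForm 1 (ofVec a) := rfl

theorem monom_one_one_eq : monom 1 1 = ((Real.sqrt 2 : ℂ) / 2) • vecForm ![0, 0, 1] := by
  funext u v
  simp [vecForm_apply, tensorForm_ofVec, monom]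

theorem monom_two_zero_eq : monom 2 0 = (-(Real.sqrt 2 : ℂ) / 2) •
    (vecForm ![1, 0, 0] + Complex.I • vecForm ![0, 1, 0]) := by
  funext u v
  have h0 := ofReal_sqrt_two_ne
  simp [vecForm_apply, tensorForm_ofVec, monom]
  field_simp
  linear_combination (u ^ 2 + v ^ 2) * Complex.I_sq

theorem monom_zero_two_eq : monom 0 2 = ((Real.sqrt 2 : ℂ) / 2) •
    (vecForm ![1, 0, 0] - Complex.I • vecForm ![0, 1, 0]) := by
  funext u v
  have h0 := ofReal_sqrt_two_ne
  simp [vecForm_apply, tensorForm_ofVec, monom]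
  field_simp
  linear_combination (u ^ 2 + v ^ 2) * Complex.I_sq

theorem binaryForm_mem {l : ℕ} {W : Submodule ℂ (ℂ → ℂ → ℂ)} (a : Order l → ℂ)
    (h : ∀ m : Order l, a m ≠ 0 → monom ((l : ℤ) + m).toNat ((l : ℤ) - m).toNat ∈ W) :
    binaryForm l a ∈ W := by
  have e : binaryForm l a = ∑ m : Order l, (a m * formWeight l m) •
      monom ((l : ℤ) + m).toNat ((l : ℤ) - m).toNat := by
    funext u v
    simp [binaryForm_apply, monom, mul_assoc]
  rw [e]
  refine Submodule.sum_mem _ fun m _ => ?_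
  by_cases hm : a m = 0
  · simp [hm]
  · exact W.smul_mem _ (h m hm)

/-- The span of the binary forms of the pseudo-maximal couplings of degree `l`. -/
def couplingSpan {n : ℕ} (l : ℕ) (r : Fin n → Fin 3 → ℝ) : Submodule ℂ (ℂ → ℂ → ℂ) :=
  Submodule.span ℂ (Set.range fun i : Fin (l + 1) → Fin n =>
    tensorForm l (pseudoMaximal l fun j => r (i j)))

/-- The span of the binary forms of the input vectors. -/
def inputSpan {n : ℕ} (r : Fin n → Fin 3 → ℝ) : Submodule ℂ (ℂ → ℂ → ℂ) :=
  Submodule.span ℂ (Set.range fun i => vecForm (r i))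

theorem mem_span_of_tensorForm_mem {n l : ℕ} {r : Fin n → Fin 3 → ℝ} {T : Order l → ℂ}
    (h : tensorForm l T ∈ couplingSpan l r) :
    T ∈ Submodule.span ℂ
      (Set.range fun i : Fin (l + 1) → Fin n => pseudoMaximal l fun j => r (i j)) := by
  rw [couplingSpan, Set.range_comp' (tensorForm l), ← Submodule.map_span] at h
  obtain ⟨T', hT', e⟩ := h
  rwa [← tensorForm_injective l e]

theorem vecForm_cross_mem {n : ℕ} (r : Fin n → Fin 3 → ℝ) (i j : Fin n) :
    vecForm (crossProduct (r i) (r j)) ∈ couplingSpan 1 r := by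
  have h : tensorForm 1 (pseudoMaximal 1 fun k => r (![i, j] k)) ∈ couplingSpan 1 r :=
    Submodule.subset_span ⟨![i, j], rfl⟩
  simp only [pseudoMaximal, contract_one_ofVec, map_smul] at h
  refine (Submodule.smul_mem_iff _ ?_).1 h
  simp

/-- Appending one more input to a coupling multiplies its form by the form of that input. -/
theorem mul_mem_couplingSpan {n l : ℕ} {r : Fin n → Fin 3 → ℝ} {f g : ℂ → ℂ → ℂ}
    (hf : f ∈ couplingSpan (l + 1) r) (hg : g ∈ inputSpan r) : f * g ∈ couplingSpan (l + 2) r := by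
  have h : couplingSpan (l + 1) r * inputSpan r ≤ couplingSpan (l + 2) r := by
    rw [couplingSpan, inputSpan, Submodule.span_mul_span, Submodule.span_le]
    rintro _ ⟨_, ⟨i, rfl⟩, _, ⟨k, rfl⟩, rfl⟩
    refine Submodule.subset_span ⟨Fin.snoc i k, ?_⟩
    simp only [pseudoMaximal]
    rw [tensorForm_contract_add (l₁ := l + 1) (l₂ := 1), vecForm_apply]
    simp
  exact h (Submodule.mul_mem_mul hf hg)

/-- A monomial of degree at least four is divisible by `u^2` or `v^2`, so one input at a time can be
split off until degree two is reached. -/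
theorem monom_mem_couplingSpan {n : ℕ} {r : Fin n → Fin 3 → ℝ}
    (h20 : monom 2 0 ∈ couplingSpan 1 r) (h11 : monom 1 1 ∈ couplingSpan 1 r)
    (h02 : monom 0 2 ∈ couplingSpan 1 r) (g20 : monom 2 0 ∈ inputSpan r)
    (g02 : monom 0 2 ∈ inputSpan r) (l a b : ℕ) (hab : a + b = 2 * (l + 1)) :
    monom a b ∈ couplingSpan (l + 1) r := by
  induction l generalizing a b with
  | zero =>
    obtain ⟨rfl, rfl⟩ | ⟨rfl, rfl⟩ | ⟨rfl, rfl⟩ :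
      (a = 2 ∧ b = 0) ∨ (a = 1 ∧ b = 1) ∨ (a = 0 ∧ b = 2) := by omega
    exacts [h20, h11, h02]
  | succ l ih =>
    by_cases ha : 2 ≤ a
    · obtain ⟨a, rfl⟩ := Nat.exists_eq_add_of_le' ha
      have := mul_mem_couplingSpan (ih a b (by omega)) g20
      rwa [monom_mul] at this
    · obtain ⟨b, rfl⟩ := Nat.exists_eq_add_of_le' (show 2 ≤ b by omega)
      have := mul_mem_couplingSpan (ih a b (by omega)) g02
      rwa [monom_mul] at this

/-- Splitting off `u^2` or `v^2` preserves the parity of both exponents, so the descent ends at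
`uv`. -/
theorem monom_mem_couplingSpan_of_odd {n : ℕ} {r : Fin n → Fin 3 → ℝ}
    (h11 : monom 1 1 ∈ couplingSpan 1 r) (g20 : monom 2 0 ∈ inputSpan r)
    (g02 : monom 0 2 ∈ inputSpan r) (l a b : ℕ) (hab : a + b = 2 * (l + 1)) (ha : Odd a) :
    monom a b ∈ couplingSpan (l + 1) r := by
  rw [Nat.odd_iff] at ha
  induction l generalizing a b with
  | zero =>
    obtain ⟨rfl, rfl⟩ : a = 1 ∧ b = 1 := by omega
    exact h11
  | succ l ih =>
    by_cases ha : 2 ≤ a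
    · obtain ⟨a, rfl⟩ := Nat.exists_eq_add_of_le' ha
      have := mul_mem_couplingSpan (ih a b (by omega) (by omega)) g20
      rwa [monom_mul] at this
    · obtain ⟨b, rfl⟩ := Nat.exists_eq_add_of_le' (show 2 ≤ b by omega)
      have := mul_mem_couplingSpan (ih a b (by omega) (by omega)) g02
      rwa [monom_mul] at this

/-- The vectors whose quadratic form lies in a given space of forms. -/
def vecFormComap (W : Submodule ℂ (ℂ → ℂ → ℂ)) : Submodule ℝ (Fin 3 → ℝ) :=
  (W.restrictScalars ℝ).comap vecForm

theorem mem_vecFormComap {W : Submodule ℂ (ℂ → ℂ → ℂ)} {a : Fin 3 → ℝ} :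
    a ∈ vecFormComap W ↔ vecForm a ∈ W := Iff.rfl

theorem monom_mem_of_basis_mem {W : Submodule ℂ (ℂ → ℂ → ℂ)} (hx : ![1, 0, 0] ∈ vecFormComap W)
    (hy : ![0, 1, 0] ∈ vecFormComap W) : monom 2 0 ∈ W ∧ monom 0 2 ∈ W := by
  rw [mem_vecFormComap] at hx hy
  rw [monom_two_zero_eq, monom_zero_two_eq]
  exact ⟨W.smul_mem _ (W.add_mem hx (W.smul_mem _ hy)),
    W.smul_mem _ (W.sub_mem hx (W.smul_mem _ hy))⟩

theorem input_mem_vecFormComap {n : ℕ} (r : Fin n → Fin 3 → ℝ) (i : Fin n) :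
    r i ∈ vecFormComap (inputSpan r) :=
  Submodule.subset_span ⟨i, rfl⟩

theorem tensorForm_mem_couplingSpan_of_triple {n : ℕ} {r : Fin n → Fin 3 → ℝ} {i j k : Fin n}
    (h : crossProduct (r i) (r j) ⬝ᵥ r k ≠ 0) {l : ℕ} (hl : 1 ≤ l) (T : Order l → ℂ) :
    tensorForm l T ∈ couplingSpan l r := by
  have hin : ∀ w, w ∈ vecFormComap (inputSpan r) := fun w => by
    refine (Submodule.smul_mem_iff _ h).1 ?_
    -- Cramer's rule for `w` in the basis of the three inputs.
    have e : (crossProduct (r i) (r j) ⬝ᵥ r k) • w =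
        (crossProduct (r j) (r k) ⬝ᵥ w) • r i + (crossProduct (r k) (r i) ⬝ᵥ w) • r j +
          (crossProduct (r i) (r j) ⬝ᵥ w) • r k := by
      funext s
      fin_cases s <;> simp [cross_apply, dotProduct, Fin.sum_univ_three] <;> ring
    rw [e]
    have hm := input_mem_vecFormComap r
    exact add_mem (add_mem (Submodule.smul_mem _ _ (hm i)) (Submodule.smul_mem _ _ (hm j)))
      (Submodule.smul_mem _ _ (hm k))
  have hcr : ∀ w, w ∈ vecFormComap (couplingSpan 1 r) := fun w => by
    refine (Submodule.smul_mem_iff _ h).1 ?_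
    -- The dual expansion: the cross products form the reciprocal basis, up to the triple product.
    have e : (crossProduct (r i) (r j) ⬝ᵥ r k) • w =
        (r i ⬝ᵥ w) • crossProduct (r j) (r k) + (r j ⬝ᵥ w) • crossProduct (r k) (r i) +
          (r k ⬝ᵥ w) • crossProduct (r i) (r j) := by
      funext s
      fin_cases s <;> simp [cross_apply, dotProduct, Fin.sum_univ_three] <;> ring
    rw [e]
    have hm := vecForm_cross_mem r
    exact add_mem (add_mem (Submodule.smul_mem _ _ (hm j k)) (Submodule.smul_mem _ _ (hm k i)))
      (Submodule.smul_mem _ _ (hm i j))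
  obtain ⟨g20, g02⟩ := monom_mem_of_basis_mem (hin _) (hin _)
  obtain ⟨h20, h02⟩ := monom_mem_of_basis_mem (hcr _) (hcr _)
  have h11 : monom 1 1 ∈ couplingSpan 1 r := by
    rw [monom_one_one_eq]
    exact Submodule.smul_mem _ _ (mem_vecFormComap.1 (hcr _))
  obtain ⟨l, rfl⟩ := Nat.exists_eq_add_of_le' hl
  rw [tensorForm, LinearMap.comp_apply]
  refine binaryForm_mem _ fun m _ => monom_mem_couplingSpan h20 h11 h02 g20 g02 l _ _ ?_
  have := m.le
  have := m.neg_le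
  omega

/-! ### Vanishing forced by equivariance. -/

theorem IsPseudotensor.toComplex_rotation {n l : ℕ} {Θ : (Fin n → Fin 3 → ℝ) → Order l → ℝ}
    (hΘ : IsPseudotensor Θ) (α β γ : ℝ) (r : Fin n → Fin 3 → ℝ) :
    toComplex (Θ fun i => rotation α β γ *ᵥ r i) = realWignerD l α β γ *ᵥ toComplex (Θ r) :=
  hΘ _ (rotation_mem_orthogonalGroup α β γ) _ ⟨α, β, γ, Or.inl ⟨rfl, rfl⟩⟩ r

theorem IsPseudotensor.toComplex_neg_rotation {n l : ℕ}
    {Θ : (Fin n → Fin 3 → ℝ) → Order l → ℝ}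
    (hΘ : IsPseudotensor Θ) (α β γ : ℝ) (r : Fin n → Fin 3 → ℝ) :
    toComplex (Θ fun i => -rotation α β γ *ᵥ r i) =
      (-(-1 : ℂ) ^ l) • realWignerD l α β γ *ᵥ toComplex (Θ r) := by
  rw [← Matrix.smul_mulVec]
  exact hΘ _ (neg_rotation_mem_orthogonalGroup α β γ) _ ⟨α, β, γ, Or.inr ⟨rfl, rfl⟩⟩ r

theorem complexComp_realWignerD_zero {l : ℕ} (α : ℝ) (T : Order l → ℂ) (m : Order l) :
    complexComp l (realWignerD l α 0 0 *ᵥ T) m =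
      Complex.exp (-Complex.I * m * α) * complexComp l T m := by
  have h : complexComp l (realWignerD l α 0 0 *ᵥ T) =
      fun m : Order l => Complex.exp (-Complex.I * m * α) * complexComp l T m := by
    apply binaryForm_injective
    funext u v
    rw [binaryForm_realWignerD]
    simp only [Complex.ofReal_zero, zero_div, mul_zero, Complex.exp_zero, Real.cos_zero,
      Real.sin_zero, Complex.ofReal_one, one_mul, zero_mul, add_zero, sub_zero]
    rw [binaryForm_apply, binaryForm_apply]
    refine Finset.sum_congr rfl fun m _ => ?_
    rw [← exp_pow_mul_exp_pow, mul_pow, mul_pow]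
    ring
  exact congrFun h m

theorem exp_neg_I_mul_int_mul_pi (m : ℤ) :
    Complex.exp (-Complex.I * m * (Real.pi : ℝ)) = (-1) ^ m.natAbs := by
  rw [show -Complex.I * m * (Real.pi : ℝ) = ((-m : ℤ) : ℂ) * (Real.pi * Complex.I) by
    push_cast; ring, Complex.exp_int_mul, Complex.exp_pi_mul_I]
  rcases Int.natAbs_eq m with h | h
  · rw [zpow_neg, h, zpow_natCast, Int.natAbs_natCast, ← inv_pow]; norm_num
  · rw [h, neg_neg, zpow_natCast, Int.natAbs_neg, Int.natAbs_natCast]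

theorem neg_rotation_pi_mulVec {a : Fin 3 → ℝ} (ha : a 2 = 0) :
    -rotation Real.pi 0 0 *ᵥ a = a := by
  rw [Matrix.neg_mulVec, rotation_mulVec, rotZ_mulVec, rotY_mulVec, rotZ_mulVec]
  funext i
  fin_cases i <;> simp [ha]

theorem neg_rotation_zero_pi_mulVec {a : Fin 3 → ℝ} (h0 : a 0 = 0) (h1 : a 1 = 0) :
    -rotation 0 Real.pi 0 *ᵥ a = a := by
  rw [Matrix.neg_mulVec, rotation_mulVec, rotZ_mulVec, rotY_mulVec, rotZ_mulVec]
  funext i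
  fin_cases i <;> simp [h0, h1]

theorem rotation_zero_mulVec (t : ℝ) {a : Fin 3 → ℝ} (h0 : a 0 = 0) (h1 : a 1 = 0) :
    rotation t 0 0 *ᵥ a = a := by
  rw [rotation_mulVec, rotZ_mulVec, rotY_mulVec, rotZ_mulVec]
  funext i
  fin_cases i <;> simp [h0, h1]

/-- The reflection in the horizontal plane is minus the half turn about the third axis. It fixes the
inputs and multiplies the component of order `m` by `-(-1)^(l+m)`. -/
theorem IsPseudotensor.complexComp_eq_zero_of_even {n l : ℕ}
    {Θ : (Fin n → Fin 3 → ℝ) → Order l → ℝ}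
    (hΘ : IsPseudotensor Θ) {r : Fin n → Fin 3 → ℝ} (hr : ∀ i, r i 2 = 0) (m : Order l)
    (hm : Even (l + m : ℤ)) : complexComp l (toComplex (Θ r)) m = 0 := by
  have h := hΘ.toComplex_neg_rotation Real.pi 0 0 r
  simp only [neg_rotation_pi_mulVec (hr _)] at h
  have h' := congrFun (congrArg (complexComp l) h) m
  rw [map_smul, Pi.smul_apply, complexComp_realWignerD_zero, exp_neg_I_mul_int_mul_pi,
    smul_eq_mul, ← mul_assoc, neg_mul, ← pow_add, Even.neg_one_pow] at h'
  · linear_combination h' / 2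
  · rw [Nat.even_iff]
    rw [Int.even_iff] at hm
    omega

theorem IsPseudotensor.toComplex_eq_zero_of_axis {n l : ℕ}
    {Θ : (Fin n → Fin 3 → ℝ) → Order l → ℝ}
    (hΘ : IsPseudotensor Θ) {r : Fin n → Fin 3 → ℝ} (h0 : ∀ i, r i 0 = 0) (h1 : ∀ i, r i 1 = 0) :
    toComplex (Θ r) = 0 := by
  have hm : ∀ m : Order l, (m : ℤ) ≠ 0 → complexComp l (toComplex (Θ r)) m = 0 := by
    intro m hm
    -- The angle `π/m` is chosen to make the phase of order `m` equal to `-1`.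
    have h := hΘ.toComplex_rotation (Real.pi / (m : ℤ)) 0 0 r
    simp only [rotation_zero_mulVec _ (h0 _) (h1 _)] at h
    have h' := congrFun (congrArg (complexComp l) h) m
    have hm' : ((m : ℤ) : ℂ) ≠ 0 := by exact_mod_cast hm
    rw [complexComp_realWignerD_zero, show -Complex.I * (m : ℤ) * (Real.pi / (m : ℤ) : ℝ) =
      -(Real.pi * Complex.I) by push_cast; field_simp, Complex.exp_neg, Complex.exp_pi_mul_I] at h'
    norm_num at h'
    linear_combination h' / 2
  have hform : ∀ u v, tensorForm l (toComplex (Θ r)) u v =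
      complexComp l (toComplex (Θ r)) ⟨0, by simp⟩ * (formWeight l 0 * (u ^ l * v ^ l)) := by
    intro u v
    change binaryForm l _ u v = _
    rw [binaryForm_apply, Finset.sum_eq_single ⟨0, by simp⟩]
    · simp
    · intro m _ hne
      rw [hm m fun e => hne (Subtype.ext e), zero_mul]
    · simp
  apply tensorForm_injective
  -- Minus the half turn about the `y` axis is a reflection fixing the third axis. It substitutes
  -- `(v, -u)` for `(u, v)`, so `u^l v^l` acquires `(-1)^l`, and the pseudotensor sign `-(-1)^l`
  -- makes the total factor `-1`.
  have h := hΘ.toComplex_neg_rotation 0 Real.pi 0 r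
  simp only [neg_rotation_zero_pi_mulVec (h0 _) (h1 _)] at h
  rw [map_zero]
  funext u v
  have h' := congrFun (congrFun (congrArg (tensorForm l) h) u) v
  rw [map_smul, Pi.smul_apply, Pi.smul_apply, tensorForm_realWignerD] at h'
  simp only [hform, smul_eq_mul] at h' ⊢
  simp only [Complex.ofReal_zero, zero_div, mul_zero, Complex.exp_zero, Real.cos_pi_div_two,
    Real.sin_pi_div_two, Complex.ofReal_one, one_mul, zero_mul, zero_add, zero_sub, neg_pow u] at h'
  have hs : ((-1 : ℂ) ^ l) * (-1) ^ l = 1 := by rw [← mul_pow]; simp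
  rw [Pi.zero_apply, Pi.zero_apply]
  linear_combination h' / 2 - (complexComp l (toComplex (Θ r)) ⟨0, by simp⟩ *
    (formWeight l 0 * (u ^ l * v ^ l))) / 2 * hs

theorem IsPseudotensor.eq_zero_of_collinear {n l : ℕ}
    {Θ : (Fin n → Fin 3 → ℝ) → Order l → ℝ}
    (hΘ : IsPseudotensor Θ) {r : Fin n → Fin 3 → ℝ}
    (hr : ∃ v : Fin 3 → ℝ, ∀ i, ∃ c : ℝ, r i = c • v) : Θ r = 0 := by
  obtain ⟨v, hv⟩ := hr
  choose c hc using hv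
  obtain ⟨α, β, ρ, hw⟩ := exists_rotation_mulVec_eq v
  have h := hΘ.toComplex_rotation α β 0 fun i => c i • ![0, 0, ρ]
  rw [hΘ.toComplex_eq_zero_of_axis (r := fun i => c i • ![0, 0, ρ]) (fun i => by simp)
    (fun i => by simp), Matrix.mulVec_zero] at h
  have e : (fun i => rotation α β 0 *ᵥ (c i • ![0, 0, ρ])) = r := by
    funext i
    rw [Matrix.mulVec_smul, ← hw, hc]
  rw [e] at h
  funext μ
  have := congrFun h μ
  simpa [toComplex] using this

theorem collinear_of_cross_eq_zero {n : ℕ} {r : Fin n → Fin 3 → ℝ}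
    (h : ∀ i j, crossProduct (r i) (r j) = 0) :
    ∃ v : Fin 3 → ℝ, ∀ i, ∃ c : ℝ, r i = c • v := by
  by_cases h0 : ∀ i, r i = 0
  · exact ⟨0, fun i => ⟨0, by simp [h0 i]⟩⟩
  push Not at h0
  obtain ⟨i, hi⟩ := h0
  refine ⟨r i, fun j => ⟨(r i ⬝ᵥ r j) / (r i ⬝ᵥ r i), ?_⟩⟩
  have hd : r i ⬝ᵥ r i ≠ 0 := fun e => hi (dotProduct_self_eq_zero.1 e)
  -- The difference of the two sides is the triple product `(r i × r j) × r i`.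
  have e : (r i ⬝ᵥ r i) • r j = (r i ⬝ᵥ r j) • r i := by
    have hc := h i j
    rw [cross_apply] at hc
    have c0 := congrFun hc 0
    have c1 := congrFun hc 1
    have c2 := congrFun hc 2
    simp at c0 c1 c2
    funext s
    fin_cases s <;> simp [dotProduct, Fin.sum_univ_three]
    · linear_combination r i 2 * c1 - r i 1 * c2
    · linear_combination r i 0 * c2 - r i 2 * c0
    · linear_combination r i 1 * c0 - r i 0 * c1
  rw [div_eq_inv_mul, mul_smul, ← e, smul_smul, inv_mul_cancel₀ hd, one_smul]

/-! ### Membership in the complex and real spans. -/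

theorem IsPseudotensor.mem_span_of_horizontal {n l : ℕ}
    {Θ : (Fin n → Fin 3 → ℝ) → Order l → ℝ}
    (hΘ : IsPseudotensor Θ) (hl : 1 ≤ l) {r : Fin n → Fin 3 → ℝ} (hr : ∀ i, r i 2 = 0) :
    toComplex (Θ r) ∈ Submodule.span ℂ
      (Set.range fun i : Fin (l + 1) → Fin n => pseudoMaximal l fun j => r (i j)) := by
  by_cases hcol : ∀ i j, crossProduct (r i) (r j) = 0
  · rw [hΘ.eq_zero_of_collinear (collinear_of_cross_eq_zero hcol)]
    exact Submodule.zero_mem _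
  push Not at hcol
  obtain ⟨i, j, hij⟩ := hcol
  have hw : crossProduct (r i) (r j) = (r i 0 * r j 1 - r i 1 * r j 0) • ![0, 0, 1] := by
    rw [cross_apply]
    funext s
    fin_cases s <;> simp [hr]
  have hD : r i 0 * r j 1 - r i 1 * r j 0 ≠ 0 := fun e => hij (by rw [hw, e, zero_smul])
  have hm := input_mem_vecFormComap r
  have hx : ![1, 0, 0] ∈ vecFormComap (inputSpan r) := by
    refine (Submodule.smul_mem_iff _ hD).1 ?_
    rw [show (r i 0 * r j 1 - r i 1 * r j 0) • ![1, 0, 0] = r j 1 • r i - r i 1 • r j by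
      funext s; fin_cases s <;> simp [hr] <;> ring]
    exact sub_mem (Submodule.smul_mem _ _ (hm i)) (Submodule.smul_mem _ _ (hm j))
  have hy : ![0, 1, 0] ∈ vecFormComap (inputSpan r) := by
    refine (Submodule.smul_mem_iff _ hD).1 ?_
    rw [show (r i 0 * r j 1 - r i 1 * r j 0) • ![0, 1, 0] = r i 0 • r j - r j 0 • r i by
      funext s; fin_cases s <;> simp [hr] <;> ring]
    exact sub_mem (Submodule.smul_mem _ _ (hm j)) (Submodule.smul_mem _ _ (hm i))
  obtain ⟨g20, g02⟩ := monom_mem_of_basis_mem hx hy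
  have h11 : monom 1 1 ∈ couplingSpan 1 r := by
    rw [monom_one_one_eq]
    refine Submodule.smul_mem _ _ (mem_vecFormComap.1 ((Submodule.smul_mem_iff _ hD).1 ?_))
    rw [← hw]
    exact vecForm_cross_mem r i j
  apply mem_span_of_tensorForm_mem
  rw [tensorForm, LinearMap.comp_apply]
  refine binaryForm_mem _ fun m hm => ?_
  have h₁ := m.le
  have h₁' := m.neg_le
  have hodd : Odd (l + m : ℤ) := by
    rw [← Int.not_even_iff_odd]
    exact fun he => hm (hΘ.complexComp_eq_zero_of_even hr m he)
  obtain ⟨l, rfl⟩ := Nat.exists_eq_add_of_le' hl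
  refine monom_mem_couplingSpan_of_odd h11 g20 g02 l _ _ (by omega) ?_
  rw [Int.odd_iff] at hodd
  rw [Nat.odd_iff]
  omega

theorem IsPseudotensor.mem_span {n l : ℕ} {Θ : (Fin n → Fin 3 → ℝ) → Order l → ℝ}
    (hΘ : IsPseudotensor Θ) (hl : 1 ≤ l) (r : Fin n → Fin 3 → ℝ) :
    toComplex (Θ r) ∈ Submodule.span ℂ
      (Set.range fun i : Fin (l + 1) → Fin n => pseudoMaximal l fun j => r (i j)) := by
  by_cases hcol : ∀ i j, crossProduct (r i) (r j) = 0
  · rw [hΘ.eq_zero_of_collinear (collinear_of_cross_eq_zero hcol)]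
    exact Submodule.zero_mem _
  push Not at hcol
  obtain ⟨i, j, hij⟩ := hcol
  by_cases htr : ∀ k, crossProduct (r i) (r j) ⬝ᵥ r k = 0
  swap
  · push Not at htr
    obtain ⟨k, hk⟩ := htr
    exact mem_span_of_tensorForm_mem (tensorForm_mem_couplingSpan_of_triple hk hl _)
  -- All inputs are now orthogonal to the nonzero normal `r i × r j`. The inverse of a rotation
  -- taking the third axis to this normal makes them horizontal.
  obtain ⟨α, β, ρ, hw⟩ := exists_rotation_mulVec_eq (crossProduct (r i) (r j))
  have hρ : ρ ≠ 0 := by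
    rintro rfl
    refine hij (hw.trans ?_)
    rw [show ![0, 0, (0 : ℝ)] = 0 by funext s; fin_cases s <;> rfl, Matrix.mulVec_zero]
  set r' : Fin n → Fin 3 → ℝ := fun k => (rotation α β 0)ᵀ *ᵥ r k with hr'
  have hz : ∀ k, r' k 2 = 0 := by
    intro k
    have h := htr k
    rw [hw, dotProduct_comm, Matrix.dotProduct_mulVec, ← Matrix.mulVec_transpose] at h
    change r' k ⬝ᵥ ![0, 0, ρ] = 0 at h
    simpa [dotProduct, Fin.sum_univ_three, hρ] using h
  have hrr : ∀ k, rotation α β 0 *ᵥ r' k = r k := fun k => rotation_mulVec_transpose_mulVec _ _ _ _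
  have h := hΘ.toComplex_rotation α β 0 r'
  simp only [hrr] at h
  rw [h]
  -- The Wigner matrix carries the couplings of the rotated inputs back to those of `r`.
  have hmem := Submodule.mem_map_of_mem (f := (realWignerD l α β 0).mulVecLin)
    (hΘ.mem_span_of_horizontal hl hz)
  rw [Submodule.map_span, ← Set.range_comp] at hmem
  simpa only [Function.comp_def, Matrix.mulVecLin_apply, realWignerD_mulVec_pseudoMaximal,
    hrr] using hmem

/-- A real tensor in the complex span of real tensors lies in their real span. -/
theorem toComplex_mem_span_real {ι : Type*} [Fintype ι] {l : ℕ} {T : Order l → ℝ}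
    {S : ι → Order l → ℂ} (hS : ∀ i, ∃ R, S i = toComplex R)
    (hT : toComplex T ∈ Submodule.span ℂ (Set.range S)) :
    toComplex T ∈ Submodule.span ℝ (Set.range S) := by
  choose R hR using hS
  obtain ⟨c, hc⟩ := (Submodule.mem_span_range_iff_exists_fun ℂ).1 hT
  -- Since `T` and the spanning tensors are real, the imaginary parts of the coefficients contribute
  -- nothing to the real part of the identity.
  refine (Submodule.mem_span_range_iff_exists_fun ℝ).2 ⟨fun i => (c i).re, ?_⟩
  funext μ
  have h := congrArg Complex.re (congrFun hc μ)
  simp only [Finset.sum_apply, Pi.smul_apply, hR, toComplex, smul_eq_mul, Complex.re_sum,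
    Complex.re_mul_ofReal, Complex.ofReal_re] at h
  simp only [Finset.sum_apply, Pi.smul_apply, hR, toComplex, Complex.real_smul]
  rw [← h]
  push_cast
  rfl

theorem IsPseudotensor.mem_span_real {n l : ℕ} {Θ : (Fin n → Fin 3 → ℝ) → Order l → ℝ}
    (hΘ : IsPseudotensor Θ) (hl : 1 ≤ l) (r : Fin n → Fin 3 → ℝ) :
    toComplex (Θ r) ∈ Submodule.span ℝ (Set.range fun i : Fin (l + 1) → Fin n =>
      Complex.I • pseudoMaximal l fun j => r (i j)) := by
  refine toComplex_mem_span_real (fun i => exists_I_smul_pseudoMaximal l _) ?_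
  -- Multiplying the generators by `i` leaves their complex span unchanged.
  refine Submodule.span_le.2 ?_ (hΘ.mem_span hl r)
  rintro _ ⟨i, rfl⟩
  exact (Submodule.smul_mem_iff _ Complex.I_ne_zero).1 (Submodule.subset_span ⟨i, rfl⟩)

end

end Harmonic

theorem proposition4 {n l : ℕ} (Θ : (Fin n → Fin 3 → ℝ) → Harmonic.Order l → ℝ)
    (hΘ : Harmonic.IsPseudotensor Θ) :
    -- the pseudotensor lies in the span of the pseudo-maximal couplings of the inputs
    (1 ≤ l → ∀ r : Fin n → Fin 3 → ℝ,
      Harmonic.toComplex (Θ r) ∈ Submodule.span ℂ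
        (Set.range fun i : Fin (l + 1) → Fin n => Harmonic.pseudoMaximal l fun j => r (i j))) ∧
    -- and it is the imaginary unit times a combination of them with real coefficients
    (1 ≤ l → ∀ r : Fin n → Fin 3 → ℝ,
      Harmonic.toComplex (Θ r) ∈ Submodule.span ℝ
        (Set.range fun i : Fin (l + 1) → Fin n =>
          Complex.I • Harmonic.pseudoMaximal l fun j => r (i j))) ∧
    -- the contraction of two vectors to degree one is a multiple of their cross product
    (∀ a b : Fin 3 → ℝ,
      Harmonic.contract 1 (Harmonic.ofVec a) (Harmonic.ofVec b) =
        (-Complex.I / (Real.sqrt 2 : ℂ)) • Harmonic.ofVec (crossProduct a b)) ∧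
    -- the pseudotensor vanishes when all inputs are collinear
    (∀ r : Fin n → Fin 3 → ℝ, (∃ v : Fin 3 → ℝ, ∀ i, ∃ c : ℝ, r i = c • v) → Θ r = 0) :=
  ⟨fun hl r => hΘ.mem_span hl r, fun hl r => hΘ.mem_span_real hl r, Harmonic.contract_one_ofVec,
    fun _ hr => hΘ.eq_zero_of_collinear hr⟩
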